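/- **Setting.** Let $\mathcal G=(\mathcal V,\mathcal E)$ be a strongly connected digraph without self-loops on $N\ge 1$ nodes. Write $\mathcal N_i^-=\{j:(j,i)\in\mathcal E\}$, $\mathcal N_i^+=\{j:(i,j)\in\mathcal E\}$ and $d_i^+=|\mathcal N_i^+|$. Let $q_{\min}<q_{\max}$, let $\mathbf y(0)\in\mathbb R^N$ be the vector of initial values, and let $\bar y(0)=\frac1N\sum_{i}y_i(0)$. For a weight matrix $\mathbf A(k)=(a_{ij}(k))$ put $$b_i(k)=\sum_{j\in\mathcal N_i^-}a_{ij}(k)-\sum_{j\in\mathcal N_i^+}a_{ji}(k).$$ **Algorithm.** For $k=0,1,2,\dots$ every node $i$ does the following. - It computes $n_i(k)=\min\Big\{\Big\lfloor \max\Big(0,\frac{b_i(k)}{d_i^+\gamma(k)}\Big)\Big\rfloor,\;2^{B_i^{(w)}(k)}-1\Big\}$. - It sets $x_i(k)=0$ if $B:=B_i^{(c)}(k)=0$. If $B>0$, put $\tilde y_i(k)=\min\{\max\{y_i(k),q_{\min}\},q_{\max}\}$, $\Delta=\frac{q_{\max}-q_{\min}}{2^{B}-1}$, $u_i(k)=\frac{\tilde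 y_i(k)-q_{\min}}{\Delta}$ and $p_i(k)=u_i(k)-\lfloor u_i(k)\rfloor$. Then, conditionally on the history up to the time before this choice is made, $x_i(k)=q_{\min}+\lceil u_i(k)\rceil\Delta$ with probability $p_i(k)$ and $x_i(k)=q_{\min}+\lfloor u_i(k)\rfloor\Delta$ with probability $1-p_i(k)$. (No independence between different nodes at the same time is required.) - It updates $a_{ij}(k+1)=a_{ij}(k)+n_j(k)\gamma(k)$ for $j\in\mathcal N_i^-$, the other entries being unchanged, and $$y_i(k+1)=y_i(k)+\alpha(k)b_i(k)x_i(k)+\alpha(k)\sum_{j\in\mathcal N_i^-}a_{ij}(k)\big(x_j(k)-x_i(k)\big).$$ **Assumptions.** 1. There are integers $c_1\ge2$, $c_2\ge1$ and $c_{ij}\ge1$ such that $\gamma(0)>0$; $\gamma(k)=\gamma(0)/c_1^n$ whenever $n\ge0$ and $(c_1^n-1)c_2\le k\le(c_1^{n+1}-1)c_2-1$; $a_{ij}(0)=c_{ij}\gamma(0)$ if $j\in\mathcal N_i^-$; and $a_{ij}(0)=0$ if $j\notin\mathcal N_i^-$. 2. There are positive integers $W$, $B_{\max}$ such that $\sum_{n=kW}^{(k+1)W-1}B_i^{(w)}(n)\ge1$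 and $B_i^{(w)}(k)\le B_{\max}$ for all $i\in\mathcal V$, $k\ge0$. 3. There are a positive integer $W'$ and $B^{(c)}(k)\in\{0,1\}$ such that $\sum_{t=nW'}^{(n+1)W'-1}B^{(c)}(t)\ge1$ for all $n\ge0$ and, for all $i$ and $k$, $B_i^{(c)}(k)\ge B^{(c)}(k)$ if $B^{(c)}(k)>0$ and $B_i^{(c)}(k)=0$ if $B^{(c)}(k)=0$. 4. $\bar y(0)\in[q_{\min},q_{\max}]$. 5. $\alpha(k)>0$ and $\alpha(k+1)\le\alpha(k)$ for all $k\ge0$, $\sum_{k\ge1}\alpha(k)=\infty$ and $\sum_{k\ge1}\alpha(k)^2<\infty$. **Theorem.** Under these assumptions: (a) $\mathbb P\big(\lim_{k\to\infty}\mathbf y(k)=\bar y(0)\mathbf 1\big)=1$; (b) for every positive integer $p$, $\mathbb E\big[\|\mathbf y(k)-\bar y(0)\mathbf 1\|^p\big]$ is finite for every $k$ and $\lim_{k\to\infty}\mathbb E\big[\|\mathbf y(k)-\bar y(0)\mathbf 1\|^p\big]=0$, where $\|\cdot\|$ is the Euclidean norm. -/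

import Mathlib

open MeasureTheory Filter Topology

noncomputable section

namespace QuantizedConsensus

variable {V : Type*} [Fintype V]

/-! ### Digraphs: an edge `i → j` is `G.Adj i j`, and information flows from `i` to `j`. -/

/-- A directed path (possibly empty) leads from every node to every node. -/
def StronglyConnected (G : Digraph V) : Prop :=
  ∀ i j : V, Relation.ReflTransGen G.Adj i j

open Classical in
/-- The in-neighbours of `i`: all `j` with an edge `j → i`. -/
def inNeighbors (G : Digraph V) (i : V) : Finset V := {j | G.Adj j i}

open Classical in
/-- The out-neighbours of `i`: all `j` with an edge `i → j`. -/
def outNeighbors (G : Digraph V) (i : V) : Finset V := {j | G.Adj i j}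

/-- The in-flow of `i`; the entry `A i j` is the weight of the edge `j → i`. -/
def inFlow (G : Digraph V) (A : Matrix V V ℝ) (i : V) : ℝ := ∑ j ∈ inNeighbors G i, A i j

/-- The out-flow of `i`. -/
def outFlow (G : Digraph V) (A : Matrix V V ℝ) (i : V) : ℝ := ∑ j ∈ outNeighbors G i, A j i

/-- The weight balance of `i`: in-flow minus out-flow. -/
def balance (G : Digraph V) (A : Matrix V V ℝ) (i : V) : ℝ := inFlow G A i - outFlow G A i

/-! ### The algorithm -/

/-- The input data of the algorithm. No condition is built in. -/
structure Input (V : Type*) where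
  /-- the communication digraph -/
  G : Digraph V
  /-- the initial weight matrix -/
  A₀ : Matrix V V ℝ
  /-- lower end of the quantization range -/
  qmin : ℝ
  /-- upper end of the quantization range -/
  qmax : ℝ
  /-- step sizes for weight balancing -/
  γ : ℕ → ℝ
  /-- step sizes for consensus -/
  α : ℕ → ℝ
  /-- `Bw k i` is the number of bits that node `i` uses at time `k` for weight balancing -/
  Bw : ℕ → V → ℕ
  /-- `Bc k i` is the number of bits that node `i` uses at time `k` for consensus -/
  Bc : ℕ → V → ℕ
  /-- the initial values -/
  y₀ : V → ℝ

namespace Input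

variable (D : Input V)

/-- The balancing signal `n_i(k)`, computed from the current weight matrix `A`; the floor `⌊x⌋₊` of
a negative real number is `0`. -/
def balancingSignal (k : ℕ) (A : Matrix V V ℝ) (i : V) : ℕ :=
  min ⌊balance D.G A i / ((outNeighbors D.G i).card * D.γ k)⌋₊ (2 ^ D.Bw k i - 1)

open Classical in
/-- The weight matrix `A(k)`: weights of edges `j → i` grow by `n_j(k) γ(k)`. -/
def weights : ℕ → Matrix V V ℝ
  | 0 => D.A₀
  | k + 1 => fun i j =>
      if j ∈ inNeighbors D.G i then
        weights k i j + (D.balancingSignal k (weights k) j : ℝ) * D.γ k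
      else weights k i j

/-- Clipping to the quantization range. -/
def clip (y : ℝ) : ℝ := min (max y D.qmin) D.qmax

/-- The width of the cells of the quantizer with `B` bits. -/
def cell (B : ℕ) : ℝ := (D.qmax - D.qmin) / (2 ^ B - 1)

/-- The position of the clipped value in units of cells. -/
def position (B : ℕ) (y : ℝ) : ℝ := (D.clip y - D.qmin) / D.cell B

/-- The probability of rounding up: the fractional part of the position. -/
def roundUpProb (B : ℕ) (y : ℝ) : ℝ := D.position B y - ⌊D.position B y⌋

open Classical in
/-- The output of the quantizer with `B` bits: `0` if `B = 0`; otherwise the position is rounded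
up if `up` holds and rounded down if not. -/
def quantize (B : ℕ) (y : ℝ) (up : Prop) : ℝ :=
  if B = 0 then 0
  else if up then D.qmin + ⌈D.position B y⌉ * D.cell B
  else D.qmin + ⌊D.position B y⌋ * D.cell B

variable {Ω : Type*}

/-- The vector `y(k)` of local estimates as a random vector. Here `up k i` is the event that node
`i` rounds up at time `k`. -/
def estimate (up : ℕ → V → Set Ω) : ℕ → Ω → EuclideanSpace ℝ V
  | 0 => fun _ => WithLp.toLp 2 D.y₀
  | k + 1 => fun ω =>
      let y := estimate up k ω
      let A := D.weights k
      let x : V → ℝ := fun i => D.quantize (D.Bc k i) (y i) (ω ∈ up k i)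
      WithLp.toLp 2 fun i =>
        y i + D.α k * balance D.G A i * x i
          + D.α k * ∑ j ∈ inNeighbors D.G i, A i j * (x j - x i)

/-- The average of the initial values. -/
def average : ℝ := (∑ i, D.y₀ i) / Fintype.card V

/-- The vector all of whose entries are the average of the initial values. -/
def averageVector : EuclideanSpace ℝ V := WithLp.toLp 2 fun _ => D.average

/-- The law of the probabilistic quantizer: whenever node `i` transmits (`0 < Bc k i`), it rounds
up with probability `p_i(k)`, conditionally on the history `ℱ k` before that choice is made.
The choices of different nodes at the same time may depend on each other. -/
def RandomRounding [mΩ : MeasurableSpace Ω] (P : Measure Ω) (ℱ : Filtration ℕ mΩ)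
    (up : ℕ → V → Set Ω) : Prop :=
  ∀ k i, 0 < D.Bc k i →
    MeasurableSet[ℱ (k + 1)] (up k i) ∧
      P[(up k i).indicator (fun _ => (1 : ℝ)) | ℱ k]
        =ᵐ[P] fun ω => D.roundUpProb (D.Bc k i) (D.estimate up k ω i)

/-! ### The assumptions on the input -/

/-- The balancing step size is divided by `c₁` at the times `(c₁ ^ n - 1) c₂`, and the initial
weights are positive integer multiples of `γ 0` on the edges and `0` elsewhere. -/
def BalancingStepAndWeights : Prop :=
  0 < D.γ 0 ∧
  (∃ c₁ c₂ : ℕ, 2 ≤ c₁ ∧ 1 ≤ c₂ ∧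
    ∀ n k : ℕ, (c₁ ^ n - 1) * c₂ ≤ k → k < (c₁ ^ (n + 1) - 1) * c₂ →
      D.γ k = D.γ 0 / (c₁ : ℝ) ^ n) ∧
  ∃ c : V → V → ℕ, ∀ i j,
    (j ∈ inNeighbors D.G i → 0 < c i j ∧ D.A₀ i j = c i j * D.γ 0) ∧
    (j ∉ inNeighbors D.G i → D.A₀ i j = 0)

/-- Every node uses a bounded number of bits for weight balancing, and at least one bit in every
time window of length `W`. -/
def BalancingBits : Prop :=
  ∃ W Bmax : ℕ, 0 < W ∧ 0 < Bmax ∧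
    (∀ k i, 1 ≤ ∑ n ∈ Finset.Ico (k * W) ((k + 1) * W), D.Bw n i) ∧ ∀ k i, D.Bw k i ≤ Bmax

/-- For consensus, at each time either all nodes transmit or none, and all transmit at least once
in every time window of length `W`. -/
def ConsensusBits : Prop :=
  ∃ W : ℕ, 0 < W ∧ ∃ B : ℕ → ℕ,
    (∀ k, B k = 0 ∨ B k = 1) ∧
    (∀ n, 1 ≤ ∑ t ∈ Finset.Ico (n * W) ((n + 1) * W), B t) ∧
    ∀ k i, (0 < B k → B k ≤ D.Bc k i) ∧ (B k = 0 → D.Bc k i = 0)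

/-- The average of the initial values lies in the quantization range. -/
def InformativeAverage : Prop := D.average ∈ Set.Icc D.qmin D.qmax

/-- The consensus step sizes are positive, non-increasing, not summable, and square-summable. -/
def ConsensusSteps : Prop :=
  (∀ k, 0 < D.α k) ∧ (∀ k, D.α (k + 1) ≤ D.α k) ∧
  Tendsto (fun n => ∑ k ∈ Finset.Icc 1 n, D.α k) atTop atTop ∧
  Summable fun k => D.α k ^ 2

end Input

end QuantizedConsensus

end

/-!
The proof has a deterministic part, about the weights, and a probabilistic one, about the estimates.

**Weights.** The weight balances move like chips in a chip-firing game, and the total negative part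
of the balances (`deficit`) never grows. If a node `s` keeps a negative balance for ever, it never
sends; a function `h` that is strictly superharmonic away from `s` then turns `∑ h_i b_i(k)` into a
potential that pays for everything that is sent. Hence the total growth of the weights is finite
(`summable_increment`), and they stay between two positive constants. While the deficit exceeds a
constant multiple of `γ(k)`, some node must send in every window of bounded length. As `γ(k)` is
comparable to `1 / k`, finiteness of the total growth gives `∑ |b_i(k)| = O(1 / k)`
(`exists_sum_abs_balance_le`), so that `∑ α(k) |b_i(k)|` converges by the Cauchy–Schwarz inequality.
The limit of the weights itself is never needed.

**Estimates.** A step is `y ↦ y - α L x`, where `L` is the out-degree Laplacian and `x` the vector of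
quantized values, that is, the clipped vector plus errors of conditional mean zero. The columns of `L` sum to
zero, so the average is preserved. Clipping is the derivative of a convex function, and this gives
`z ⬝ L w ≥ c ∑ (w_i - w_j)² - O(|b| |z|²)` for the distances `z` of the estimates, and `w` of the
clipped estimates, from the average (`le_sum_mul_laplacian`). Therefore `1 + |z|²` (`energy`) is an
almost supermartingale with summable perturbations (`exists_energy_succ_le`). By the
Robbins–Siegmund theorem it converges almost surely, and `α ∑ (w_i - w_j)²` is summable along the
transmission times, where the sum of `α` is infinite. So the disagreement `∑ (w_i - w_j)²` has lower
limit zero, which by compactness forces `z → 0` (`tendsto_estimate`). All moments of the energy are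
bounded in time, because the noise is at most `O(α)` times the energy
(`exists_integral_pow_le_of_almost_supermartingale`); this upgrades almost sure convergence to
convergence of moments.
-/

namespace QuantizedConsensus

variable {V : Type*} [Fintype V]

/-! ### Digraphs -/

@[simp]
lemma mem_inNeighbors {G : Digraph V} {i j : V} : j ∈ inNeighbors G i ↔ G.Adj j i := by
  simp [inNeighbors]

@[simp]
lemma mem_outNeighbors {G : Digraph V} {i j : V} : j ∈ outNeighbors G i ↔ G.Adj i j := by
  simp [outNeighbors]

/-- Double counting of the edges: by their heads and by their tails. -/
lemma sum_inNeighbors_comm (G : Digraph V) (f : V → V → ℝ) :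
    ∑ i, ∑ j ∈ inNeighbors G i, f i j = ∑ j, ∑ i ∈ outNeighbors G j, f i j :=
  Finset.sum_comm' (by simp)

lemma sum_balance (G : Digraph V) (A : Matrix V V ℝ) : ∑ i, balance G A i = 0 := by
  simp only [balance, inFlow, outFlow, Finset.sum_sub_distrib]
  rw [sum_inNeighbors_comm G fun i j => A i j, sub_self]

/-- A strict supersolution of the hitting problem of `s`: at every node other than `s`, the mean of
`h` over the out-neighbours is less than `h` itself. For `h` one can take `1 - q ^ r`, where `r` is
the length of a shortest path to `s` and `q` is small: along the first edge of such a path, `h`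
drops by more than it can gain along all the other edges together. -/
lemma exists_strict_supersolution {G : Digraph V} (hconn : StronglyConnected G) (s : V) :
    ∃ (h : V → ℝ) (δ : ℝ), (∀ i, 0 ≤ h i) ∧ 0 < δ ∧
      ∀ i, i ≠ s → ∑ j ∈ outNeighbors G i, h j + δ ≤ (outNeighbors G i).card * h i := by
  classical
  -- `r` is the length of a shortest path to `s`
  obtain ⟨r, hr⟩ : ∃ r : V → ℕ, ∀ i, i ≠ s → ∃ j, G.Adj i j ∧ r j < r i := by
    let reach : ℕ → V → Prop := Nat.rec (motive := fun _ => V → Prop) (fun i => i = s)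
      fun _ p i => ∃ j, G.Adj i j ∧ p j
    have hex : ∀ i, ∃ n, reach n i := fun i => by
      induction hconn i s using Relation.ReflTransGen.head_induction_on with
      | refl => exact ⟨0, rfl⟩
      | head hab _ ih => obtain ⟨n, hn⟩ := ih; exact ⟨n + 1, _, hab, hn⟩
    let r : V → ℕ := fun i => Nat.find (hex i)
    refine ⟨r, fun i hi => ?_⟩
    have hspec := Nat.find_spec (hex i)
    rcases hn : Nat.find (hex i) with _ | n
    · rw [hn] at hspec; exact absurd hspec hi
    · rw [hn] at hspec
      obtain ⟨j, hij, hj⟩ := hspec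
      have hle : r j ≤ n := Nat.find_min' (hex j) hj
      have hri : r i = n + 1 := hn
      exact ⟨j, hij, by omega⟩
  set N : ℝ := (Fintype.card V : ℝ)
  have hN : 0 ≤ N := by positivity
  set q : ℝ := 1 / (N + 2) with hq
  have hq0 : 0 < q := by positivity
  have hqN : q * (N + 2) = 1 := by rw [hq]; field_simp
  have hq1 : q ≤ 1 := by nlinarith
  refine ⟨fun i => 1 - q ^ r i, q ^ (∑ i, r i),
    fun i => sub_nonneg.2 (pow_le_one₀ hq0.le hq1), by positivity, fun i hi => ?_⟩
  obtain ⟨j, hij, hj⟩ := hr i hi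
  have hjm : j ∈ outNeighbors G i := by simpa
  have hsum : q ^ r j ≤ ∑ l ∈ outNeighbors G i, q ^ r l :=
    Finset.single_le_sum (f := fun l => q ^ r l) (fun l _ => by positivity) hjm
  have hcard : ((outNeighbors G i).card : ℝ) ≤ N := by
    exact Nat.cast_le.2 (Finset.card_le_univ _)
  have h1 : q ^ (∑ i, r i) ≤ q ^ r i :=
    pow_le_pow_of_le_one hq0.le hq1 (Finset.single_le_sum (fun _ _ => Nat.zero_le _)
      (Finset.mem_univ i))
  have h2 : q ^ r i ≤ q * q ^ r j := by
    rw [← pow_succ']; exact pow_le_pow_of_le_one hq0.le hq1 hj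
  have hj0 : 0 < q ^ r i := by positivity
  simp only [Finset.sum_sub_distrib, Finset.sum_const, nsmul_eq_mul, mul_one]
  have h3 : (N + 2) * q ^ r i ≤ q ^ r j := by
    calc (N + 2) * q ^ r i ≤ (N + 2) * (q * q ^ r j) := by gcongr
      _ = (q * (N + 2)) * q ^ r j := by ring
      _ = q ^ r j := by rw [hqN, one_mul]
  nlinarith

namespace Input

variable {D : Input V}

/-! ### Weight balancing -/

/-- The amount `n_i(k) γ(k)` by which the weights of all edges leaving `i` grow at time `k`. -/
noncomputable def increment (D : Input V) (k : ℕ) (i : V) : ℝ :=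
  D.balancingSignal k (D.weights k) i * D.γ k

/-- The total negative part of the weight balances at time `k`. -/
noncomputable def deficit (D : Input V) (k : ℕ) : ℝ :=
  ∑ i, max (-balance D.G (D.weights k) i) 0

/-- The balancing step size is positive, antitone, and comparable to `1 / (k + 1)`. -/
lemma BalancingStepAndWeights.step_bounds (hγ : D.BalancingStepAndWeights) :
    (∀ k, 0 < D.γ k) ∧ Antitone D.γ ∧
      ∃ c C : ℝ, 0 < c ∧ 0 < C ∧ ∀ k : ℕ, c / (k + 1) ≤ D.γ k ∧ D.γ k ≤ C / (k + 1) := by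
  obtain ⟨h0, ⟨c₁, c₂, hc₁, hc₂, hstep⟩, -⟩ := hγ
  have hpos : ∀ n, 1 ≤ c₁ ^ n := fun n => Nat.one_le_pow _ _ (by omega)
  have hex : ∀ k, ∃ n, k < (c₁ ^ (n + 1) - 1) * c₂ := fun k => by
    refine ⟨k, ?_⟩
    have h1 : k + 1 < c₁ ^ (k + 1) := Nat.lt_pow_self hc₁
    calc k < c₁ ^ (k + 1) - 1 := by omega
      _ ≤ _ := Nat.le_mul_of_pos_right _ hc₂
  -- `n k` is the number of divisions of the step size up to time `k`
  have hphase : ∀ k, ∃ n, (c₁ ^ n - 1) * c₂ ≤ k ∧ k < (c₁ ^ (n + 1) - 1) * c₂ := fun k => by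
    classical
    refine ⟨Nat.find (hex k), ?_, Nat.find_spec (hex k)⟩
    rcases hn : Nat.find (hex k) with _ | n
    · simp
    · exact not_lt.1 (Nat.find_min (hex k) (m := n) (by omega))
  choose n hn1 hn2 using hphase
  have hγn : ∀ k, D.γ k = D.γ 0 / (c₁ : ℝ) ^ n k := fun k => hstep _ _ (hn1 k) (hn2 k)
  have hc1R : (1 : ℝ) ≤ c₁ := by exact_mod_cast (by omega : 1 ≤ c₁)
  have hc2R : (1 : ℝ) ≤ c₂ := by exact_mod_cast hc₂
  refine ⟨fun k => by rw [hγn]; positivity, fun k l hkl => ?_,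
    D.γ 0, D.γ 0 * c₁ * c₂, h0, by positivity, fun k => ?_⟩
  · rw [hγn k, hγn l]
    have : n k ≤ n l := by
      by_contra! hlt
      have h1 : c₁ ^ (n l + 1) ≤ c₁ ^ n k := Nat.pow_le_pow_right (by omega) hlt
      have h2 : (c₁ ^ (n l + 1) - 1) * c₂ ≤ (c₁ ^ n k - 1) * c₂ :=
        Nat.mul_le_mul_right _ (by omega)
      have := hn1 k
      have := hn2 l
      omega
    gcongr
  · rw [hγn k]
    have h1 : ((c₁ : ℝ) ^ n k - 1) * c₂ ≤ k := by
      have := hn1 k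
      have h := hpos (n k)
      have h' : (((c₁ ^ n k - 1) * c₂ : ℕ) : ℝ) ≤ k := by exact_mod_cast this
      simpa [Nat.cast_sub h] using h'
    have h2 : (k : ℝ) < ((c₁ : ℝ) ^ (n k + 1) - 1) * c₂ := by
      have := hn2 k
      have h := hpos (n k + 1)
      have h' : (k : ℝ) < (((c₁ ^ (n k + 1) - 1) * c₂ : ℕ) : ℝ) := by exact_mod_cast this
      simpa [Nat.cast_sub h] using h'
    have hp : (1 : ℝ) ≤ (c₁ : ℝ) ^ n k := one_le_pow₀ hc1R
    constructor
    · gcongr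
      nlinarith
    · rw [div_le_div_iff₀ (by positivity) (by positivity)]
      rw [pow_succ] at h2
      have : (k : ℝ) + 1 ≤ (c₁ : ℝ) ^ n k * c₁ * c₂ := by nlinarith
      nlinarith

lemma weights_succ (k : ℕ) (i j : V) (h : j ∈ inNeighbors D.G i) :
    D.weights (k + 1) i j = D.weights k i j + D.increment k j := by
  simp only [weights, h, if_true, increment]

/-- The weight balance moves like chips in a chip-firing game. -/
lemma balance_weights_succ (k : ℕ) (i : V) :
    balance D.G (D.weights (k + 1)) i = balance D.G (D.weights k) i
      + ∑ j ∈ inNeighbors D.G i, D.increment k j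
      - (outNeighbors D.G i).card * D.increment k i := by
  have h1 : inFlow D.G (D.weights (k + 1)) i = inFlow D.G (D.weights k) i
      + ∑ j ∈ inNeighbors D.G i, D.increment k j := by
    rw [inFlow, inFlow, ← Finset.sum_add_distrib]
    exact Finset.sum_congr rfl fun j hj => weights_succ k i j hj
  have h2 : outFlow D.G (D.weights (k + 1)) i = outFlow D.G (D.weights k) i
      + (outNeighbors D.G i).card * D.increment k i := by
    rw [outFlow, outFlow, ← nsmul_eq_mul, ← Finset.sum_const, ← Finset.sum_add_distrib]
    exact Finset.sum_congr rfl fun j hj => weights_succ k j i (by simpa using hj)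
  rw [balance, balance, h1, h2]; ring

lemma increment_nonneg (hpos : ∀ k, 0 < D.γ k) (k : ℕ) (i : V) : 0 ≤ D.increment k i :=
  mul_nonneg (Nat.cast_nonneg _) (hpos k).le

/-- No node sends more than its positive balance. -/
lemma card_mul_increment_le (hpos : ∀ k, 0 < D.γ k) (k : ℕ) (i : V) :
    (outNeighbors D.G i).card * D.increment k i ≤ max (balance D.G (D.weights k) i) 0 := by
  set b := balance D.G (D.weights k) i with hb
  rcases (Nat.zero_le (outNeighbors D.G i).card).eq_or_lt with hd | hd
  · simp [← hd]
  have hdγ : 0 < ((outNeighbors D.G i).card : ℝ) * D.γ k := by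
    have := hpos k
    positivity
  have h1 : (D.balancingSignal k (D.weights k) i : ℝ)
      ≤ max (b / ((outNeighbors D.G i).card * D.γ k)) 0 := by
    rcases le_or_gt 0 b with h | h
    · refine le_max_of_le_left ((Nat.cast_le.2 (min_le_left _ _)).trans ?_)
      exact Nat.floor_le (by positivity)
    · refine le_max_of_le_right ((Nat.cast_le.2 (min_le_left _ _)).trans ?_)
      rw [Nat.floor_of_nonpos (div_nonpos_of_nonpos_of_nonneg h.le hdγ.le), Nat.cast_zero]
  calc (outNeighbors D.G i).card * D.increment k i
      = D.balancingSignal k (D.weights k) i * ((outNeighbors D.G i).card * D.γ k) := by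
        rw [increment]; ring
    _ ≤ max (b / ((outNeighbors D.G i).card * D.γ k)) 0
          * ((outNeighbors D.G i).card * D.γ k) := by gcongr
    _ = max b 0 := by
        rw [max_mul_of_nonneg _ _ hdγ.le, zero_mul, div_mul_cancel₀ _ hdγ.ne']

lemma increment_eq_zero (hpos : ∀ k, 0 < D.γ k) {k : ℕ} {i : V}
    (h : balance D.G (D.weights k) i ≤ 0) : D.increment k i = 0 := by
  have h1 : balance D.G (D.weights k) i / ((outNeighbors D.G i).card * D.γ k) ≤ 0 :=
    div_nonpos_of_nonpos_of_nonneg h (mul_nonneg (Nat.cast_nonneg _) (hpos k).le)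
  simp [increment, balancingSignal, Nat.floor_of_nonpos h1]

lemma sum_increment_nonneg (hpos : ∀ k, 0 < D.γ k) (k : ℕ) : 0 ≤ ∑ i, D.increment k i :=
  Finset.sum_nonneg fun i _ => increment_nonneg hpos k i

/-- The negative part of a balance does not grow: a node that sends keeps a nonnegative balance. -/
lemma negPart_balance_antitone (hpos : ∀ k, 0 < D.γ k) (i : V) :
    Antitone fun k => max (-balance D.G (D.weights k) i) 0 := by
  refine antitone_nat_of_succ_le fun k => ?_
  have h1 := balance_weights_succ (D := D) k i
  have h2 : 0 ≤ ∑ j ∈ inNeighbors D.G i, D.increment k j :=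
    Finset.sum_nonneg fun j _ => increment_nonneg hpos k j
  rcases le_or_gt (balance D.G (D.weights k) i) 0 with h | h
  · rw [increment_eq_zero hpos h, mul_zero] at h1
    exact max_le_max (by linarith) le_rfl
  · have h3 := card_mul_increment_le hpos k i
    rw [max_eq_left h.le] at h3
    exact max_le (le_max_of_le_right (by linarith)) (le_max_right _ _)

lemma deficit_antitone (hpos : ∀ k, 0 < D.γ k) : Antitone D.deficit := fun _ _ hkl =>
  Finset.sum_le_sum fun i _ => negPart_balance_antitone hpos i hkl

/-- As the balances sum to zero, their positive parts sum to the deficit. -/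
lemma sum_posPart_balance (k : ℕ) :
    ∑ i, max (balance D.G (D.weights k) i) 0 = D.deficit k := by
  rw [← sub_eq_zero, deficit, ← Finset.sum_sub_distrib]
  refine Eq.trans ?_ (sum_balance D.G (D.weights k))
  refine Finset.sum_congr rfl fun i _ => ?_
  rcases le_total (balance D.G (D.weights k) i) 0 with h | h
  · rw [max_eq_right h, max_eq_left (by linarith)]; ring
  · rw [max_eq_left h, max_eq_right (by linarith)]; ring

lemma sum_abs_balance (k : ℕ) :
    ∑ i, |balance D.G (D.weights k) i| = 2 * D.deficit k := by
  rw [two_mul]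
  nth_rewrite 1 [← sum_posPart_balance]
  rw [deficit, ← Finset.sum_add_distrib]
  refine Finset.sum_congr rfl fun i _ => ?_
  rcases le_total (balance D.G (D.weights k) i) 0 with h | h
  · rw [max_eq_right h, max_eq_left (by linarith), abs_of_nonpos h]; ring
  · rw [max_eq_left h, max_eq_right (by linarith), abs_of_nonneg h]; ring

/-- The weights grow by a finite total amount. Either all balances become nonnegative, and then they
vanish and nothing is sent any more; or some node `s` keeps a negative balance. Such a node never
sends, so that a strict supersolution `h` for `s` makes `∑ h_i b_i(k)` decrease at least in
proportion to the amount sent, whereas it is bounded below. -/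
lemma summable_increment (hpos : ∀ k, 0 < D.γ k) (hconn : StronglyConnected D.G) :
    Summable fun k => ∑ i, D.increment k i := by
  by_cases hneg : ∃ s, ∀ k, balance D.G (D.weights k) s < 0
  · obtain ⟨s, hs⟩ := hneg
    obtain ⟨h, δ, h0, hδ, hh⟩ := exists_strict_supersolution hconn s
    set Φ : ℕ → ℝ := fun k => ∑ i, h i * balance D.G (D.weights k) i with hΦ
    have hstep : ∀ k, δ * ∑ i, D.increment k i ≤ Φ k - Φ (k + 1) := fun k => by
      have h1 : Φ k - Φ (k + 1) = ∑ j, ((outNeighbors D.G j).card * h j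
          - ∑ i ∈ outNeighbors D.G j, h i) * D.increment k j := by
        have h2 := sum_inNeighbors_comm D.G fun i j => h i * D.increment k j
        simp only [hΦ, balance_weights_succ, sub_mul, Finset.sum_sub_distrib, mul_sub, mul_add,
          Finset.sum_add_distrib, Finset.mul_sum, Finset.sum_mul, h2]
        simp only [mul_left_comm (h _), mul_assoc]
        ring
      rw [h1, Finset.mul_sum]
      refine Finset.sum_le_sum fun j _ => ?_
      rcases eq_or_ne j s with rfl | hj
      · simp [increment_eq_zero hpos (hs k).le]
      · have := hh j hj
        exact mul_le_mul_of_nonneg_right (by linarith) (increment_nonneg hpos k j)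
    have hlow : ∀ k, -∑ i, h i * max (-balance D.G (D.weights 0) i) 0 ≤ Φ k := fun k => by
      rw [hΦ, ← Finset.sum_neg_distrib]
      refine Finset.sum_le_sum fun i _ => ?_
      have h1 := negPart_balance_antitone hpos i (Nat.zero_le k)
      have h2 := le_max_left (-balance D.G (D.weights k) i) 0
      have := mul_le_mul_of_nonneg_left (h2.trans h1) (h0 i)
      linarith
    refine summable_of_sum_range_le (sum_increment_nonneg hpos)
      (c := (Φ 0 + ∑ i, h i * max (-balance D.G (D.weights 0) i) 0) / δ) fun n => ?_
    rw [le_div_iff₀ hδ, mul_comm, Finset.mul_sum]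
    have h3 := Finset.sum_le_sum fun k (_ : k ∈ Finset.range n) => hstep k
    rw [Finset.sum_range_sub'] at h3
    linarith [hlow n]
  · push Not at hneg
    choose K hK using hneg
    refine summable_of_hasFiniteSupport ((Set.finite_Iio (Finset.univ.sup K)).subset fun k hk => ?_)
    by_contra hlt
    have hle : Finset.univ.sup K ≤ k := not_lt.1 hlt
    refine hk (Finset.sum_eq_zero fun i _ => increment_eq_zero hpos ?_)
    have hall : ∀ i, 0 ≤ balance D.G (D.weights k) i := fun i => by
      have h1 := negPart_balance_antitone hpos i ((Finset.le_sup (Finset.mem_univ i)).trans hle)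
      simp only at h1
      rw [max_eq_right (by linarith [hK i] : -balance D.G (D.weights (K i)) i ≤ 0)] at h1
      linarith [le_max_left (-balance D.G (D.weights k) i) 0]
    exact ((Finset.sum_eq_zero_iff_of_nonneg fun i _ => hall i).1
      (sum_balance D.G (D.weights k)) i (Finset.mem_univ i)).le

/-- If the deficit is too large for all nodes to be idle, then some node sends soon. -/
lemma exists_le_sum_increment (hconn : StronglyConnected D.G) (hpos : ∀ k, 0 < D.γ k)
    (hanti : Antitone D.γ) {W : ℕ} (hW : 0 < W)
    (hbits : ∀ k i, 1 ≤ ∑ n ∈ Finset.Ico (k * W) ((k + 1) * W), D.Bw n i) {k : ℕ}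
    (hk : (∑ i, ((outNeighbors D.G i).card : ℝ)) * D.γ k < D.deficit k) :
    ∃ l ∈ Finset.Ico k (k + 2 * W), D.γ (k + 2 * W) ≤ ∑ i, D.increment l i := by
  obtain ⟨i, hi⟩ : ∃ i, (outNeighbors D.G i).card * D.γ k < balance D.G (D.weights k) i := by
    rw [← sum_posPart_balance, Finset.sum_mul] at hk
    obtain ⟨i, -, hi⟩ := Finset.exists_lt_of_sum_lt hk
    refine ⟨i, (lt_max_iff.1 hi).resolve_right (not_lt.2 ?_)⟩
    have := hpos k
    positivity
  have hi0 : 0 < balance D.G (D.weights k) i :=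
    lt_of_le_of_lt (mul_nonneg (Nat.cast_nonneg _) (hpos k).le) hi
  have hd : 0 < (outNeighbors D.G i).card := by
    obtain ⟨j, hj⟩ : ∃ j, balance D.G (D.weights k) j < 0 := by
      by_contra! hall
      exact hi0.ne' ((Finset.sum_eq_zero_iff_of_nonneg fun i _ => hall i).1
        (sum_balance D.G (D.weights k)) i (Finset.mem_univ i))
    rcases (hconn i j).cases_head with rfl | ⟨l, hl, -⟩
    · exact absurd hj hi0.not_gt
    · exact Finset.card_pos.2 ⟨l, by simpa using hl⟩
  obtain ⟨t, ht, htB⟩ : ∃ t ∈ Finset.Ico ((k / W + 1) * W) ((k / W + 1 + 1) * W), D.Bw t i ≠ 0 :=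
    Finset.exists_ne_zero_of_sum_ne_zero (Nat.one_le_iff_ne_zero.1 (hbits _ _))
  have hkt : k ≤ t ∧ t < k + 2 * W := by
    rw [Finset.mem_Ico] at ht
    have h1 := Nat.div_add_mod k W
    have h2 := Nat.mod_lt k hW
    have h3 : (k / W + 1) * W = W * (k / W) + W := by ring
    have h4 : (k / W + 1 + 1) * W = W * (k / W) + 2 * W := by ring
    omega
  by_contra! hsmall
  have hidle : ∀ l, k ≤ l → l ≤ t → D.balancingSignal l (D.weights l) i = 0 := fun l h1 h2 => by
    have h3 := hsmall l (Finset.mem_Ico.2 ⟨h1, by omega⟩)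
    have h4 : D.increment l i ≤ ∑ i, D.increment l i :=
      Finset.single_le_sum (fun j _ => increment_nonneg hpos l j) (Finset.mem_univ i)
    have h5 : D.increment l i < 1 * D.γ l := by
      rw [one_mul]; exact (h4.trans_lt h3).trans_le (hanti (by omega))
    have h6 := lt_of_mul_lt_mul_right h5 (hpos l).le
    have : D.balancingSignal l (D.weights l) i < 1 := by exact_mod_cast h6
    omega
  have hmono : ∀ l, k ≤ l → l ≤ t →
      balance D.G (D.weights k) i ≤ balance D.G (D.weights l) i := fun l h1 => by
    induction l, h1 using Nat.le_induction with
    | base => intro _; exact le_rfl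
    | succ l h1 ih =>
      intro h2
      have h3 := balance_weights_succ (D := D) l i
      have h4 : D.increment l i = 0 := by simp [increment, hidle l h1 (by omega)]
      have h5 : 0 ≤ ∑ j ∈ inNeighbors D.G i, D.increment l j :=
        Finset.sum_nonneg fun j _ => increment_nonneg hpos l j
      rw [h4] at h3
      linarith [ih (by omega)]
  -- at the time `t`, node `i` has a bit at its disposal and still enough balance to send
  have hfloor : 1 ≤ ⌊balance D.G (D.weights t) i / ((outNeighbors D.G i).card * D.γ t)⌋₊ := by
    have hpt := hpos t
    have := hanti hkt.1
    rw [Nat.one_le_floor_iff, one_le_div (by positivity)]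
    calc (outNeighbors D.G i).card * D.γ t ≤ (outNeighbors D.G i).card * D.γ k := by gcongr
      _ ≤ _ := hi.le.trans (hmono t hkt.1 le_rfl)
  have hbit : 2 ≤ 2 ^ D.Bw t i := Nat.le_self_pow htB 2
  have := hidle t hkt.1 le_rfl
  rw [balancingSignal] at this
  omega

/-- The weight balances decay like `1 / k`: were the deficit at time `2 k` larger than a multiple of
`γ(k)`, then the nodes would have sent on a fixed proportion of the steps from `k` to `2 k`, in
total a fixed amount, since `γ` decays like `1 / k`. -/
lemma exists_sum_abs_balance_le (hconn : StronglyConnected D.G)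
    (hγ : D.BalancingStepAndWeights) (hBw : D.BalancingBits) :
    ∃ C : ℝ, ∀ᶠ k : ℕ in atTop, ∑ i, |balance D.G (D.weights k) i| ≤ C / (k + 1) := by
  obtain ⟨hpos, hanti, c, C, hc, hC, hcC⟩ := hγ.step_bounds
  obtain ⟨W, -, hW, -, hbits, -⟩ := hBw
  set E : ℝ := ∑ i, ((outNeighbors D.G i).card : ℝ)
  have hE : 0 ≤ E := by positivity
  have hF0 := sum_increment_nonneg hpos
  have hsum := summable_increment hpos hconn
  -- each of `m` consecutive windows of length `2 * W` sees at least one node send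
  have hblock : ∀ k q, E * D.γ k < D.deficit (k + 2 * W * q) → ∀ m ≤ q,
      m * D.γ (k + 2 * W * q) ≤ ∑ l ∈ Finset.Ico k (k + 2 * W * m), ∑ i, D.increment l i := by
    intro k q hdef m hm
    induction m with
    | zero => simp
    | succ m ih =>
      have hmq : 2 * W * (m + 1) ≤ 2 * W * q := Nat.mul_le_mul_left _ hm
      have hmm : 2 * W * (m + 1) = 2 * W * m + 2 * W := by ring
      have h1 : E * D.γ (k + 2 * W * m) < D.deficit (k + 2 * W * m) :=
        calc E * D.γ (k + 2 * W * m) ≤ E * D.γ k :=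
              mul_le_mul_of_nonneg_left (hanti (by omega)) hE
          _ < _ := hdef
          _ ≤ _ := deficit_antitone hpos (by omega)
      obtain ⟨l, hl, hle⟩ := exists_le_sum_increment hconn hpos hanti hW hbits h1
      have h2 : D.γ (k + 2 * W * q) ≤ D.γ (k + 2 * W * m + 2 * W) := hanti (by omega)
      have h3 := Finset.single_le_sum (f := fun l => ∑ i, D.increment l i)
        (fun l _ => hF0 l) hl
      rw [hmm, ← add_assoc, ← Finset.sum_Ico_consecutive _ (m := k) (n := k + 2 * W * m)
        (k := k + 2 * W * m + 2 * W) (by omega) (by omega)]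
      have := ih (by omega)
      push_cast
      linarith
  have hWR : (0 : ℝ) < W := by exact_mod_cast hW
  -- from `k` to `2 * k` there are at least `k / (4 * W)` windows, and each of them contributes at
  -- least `c / (2 * k + 1) ≥ c / (3 * k)`: in total, at least `c / (12 * W)`
  obtain ⟨K, hK⟩ : ∃ K, ∀ k ≥ K, ∀ l,
      ∑ l ∈ Finset.Ico k l, ∑ i, D.increment l i < c / (12 * W) := by
    have h1 := (tendsto_order.1 (tendsto_sum_nat_add fun k => ∑ i, D.increment k i)).2
      (c / (12 * W)) (by positivity)
    obtain ⟨K, hK⟩ := eventually_atTop.1 h1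
    refine ⟨K, fun k hk l => lt_of_le_of_lt ?_ (hK k hk)⟩
    rw [Finset.sum_Ico_eq_sum_range]
    simp_rw [add_comm k]
    exact ((summable_nat_add_iff k).2 hsum).sum_le_tsum _ fun l _ => hF0 _
  have hdouble : ∀ k, K ≤ k → 2 * W ≤ k → D.deficit (2 * k) ≤ E * D.γ k := fun k hk hWk => by
    by_contra! hdef
    set q := k / (2 * W) with hq
    have hqk : 2 * W * q ≤ k := Nat.mul_div_le _ _
    have hkq : k < 2 * W * (q + 1) := Nat.lt_mul_div_succ _ (by omega)
    have hq1 : 1 ≤ q := (Nat.one_le_div_iff (by omega)).2 hWk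
    have h1 := hblock k q (hdef.trans_le (deficit_antitone hpos (by omega))) q le_rfl
    have h2 := hK k hk (k + 2 * W * q)
    have h3 := (hcC (2 * k)).1
    have h4 : D.γ (2 * k) ≤ D.γ (k + 2 * W * q) := hanti (by omega)
    have hkqR : (k : ℝ) < 2 * W * (q + 1) := by exact_mod_cast hkq
    have hq1R : (1 : ℝ) ≤ q := by exact_mod_cast hq1
    have hk1R : (1 : ℝ) ≤ k := by exact_mod_cast (by omega : 1 ≤ k)
    have h5 : c / (12 * W) ≤ q * (c / (2 * k + 1)) := by
      rw [mul_div_assoc', div_le_div_iff₀ (by positivity) (by positivity)]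
      have : 2 * (k : ℝ) + 1 ≤ q * (12 * W) := by nlinarith
      nlinarith
    have h6 : q * (c / (2 * k + 1)) ≤ q * D.γ (k + 2 * W * q) := by
      push_cast at h3
      exact mul_le_mul_of_nonneg_left (h3.trans h4) (by positivity)
    linarith
  refine ⟨4 * E * C, eventually_atTop.2 ⟨2 * (K + 2 * W), fun n hn => ?_⟩⟩
  rw [sum_abs_balance]
  have h1 := hdouble (n / 2) (by omega) (by omega)
  have h2 : D.deficit n ≤ D.deficit (2 * (n / 2)) := deficit_antitone hpos (by omega)
  have h3 : D.γ (n / 2) ≤ 2 * C / (n + 1) := by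
    refine (hcC _).2.trans ?_
    rw [div_le_div_iff₀ (by positivity) (by positivity)]
    have : (n : ℝ) + 1 ≤ 2 * ((n / 2 : ℕ) + 1) := by
      exact_mod_cast (by omega : n + 1 ≤ 2 * (n / 2 + 1))
    nlinarith
  calc 2 * D.deficit n ≤ 2 * (E * (2 * C / (n + 1))) := by
        have := mul_le_mul_of_nonneg_left h3 hE
        linarith
    _ = 4 * E * C / (n + 1) := by ring

lemma summable_step_mul_balance (hconn : StronglyConnected D.G)
    (hγ : D.BalancingStepAndWeights) (hBw : D.BalancingBits) (hα : Summable fun k => D.α k ^ 2)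
    (hα0 : ∀ k, 0 < D.α k) :
    Summable fun k => D.α k * ∑ i, |balance D.G (D.weights k) i| := by
  obtain ⟨C, hC⟩ := exists_sum_abs_balance_le hconn hγ hBw
  have h1 : Summable fun k : ℕ => C ^ 2 * (1 / ((k : ℝ) + 1) ^ 2) := by
    have := (summable_nat_add_iff 1).2 (Real.summable_one_div_nat_pow.2 one_lt_two)
    exact (by simpa using this : Summable fun k : ℕ => (1 / ((k : ℝ) + 1) ^ 2)).mul_left _
  refine Summable.of_norm_bounded_eventually_nat (hα.add h1) ?_
  filter_upwards [hC] with k hk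
  have h0 : 0 ≤ ∑ i, |balance D.G (D.weights k) i| := by positivity
  rw [Real.norm_of_nonneg (mul_nonneg (hα0 k).le h0)]
  have h2 := mul_le_mul_of_nonneg_left hk (hα0 k).le
  have h3 : C ^ 2 * (1 / ((k : ℝ) + 1) ^ 2) = (C / (k + 1)) ^ 2 := by rw [div_pow]; ring
  rw [h3]
  nlinarith [sq_nonneg (D.α k - C / (k + 1)), sq_nonneg (D.α k), sq_nonneg (C / ((k : ℝ) + 1))]

/-- The weights of the edges stay between two positive constants. -/
lemma exists_weights_bounds (hconn : StronglyConnected D.G) (hγ : D.BalancingStepAndWeights) :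
    ∃ a M : ℝ, 0 < a ∧ 0 < M ∧ ∀ k i j, j ∈ inNeighbors D.G i →
      a ≤ D.weights k i j ∧ D.weights k i j ≤ M := by
  have hpos := hγ.step_bounds.1
  have hsum := summable_increment hpos hconn
  have hF0 := sum_increment_nonneg hpos
  obtain ⟨h0, -, c, hc⟩ := hγ
  have hform : ∀ k i j, j ∈ inNeighbors D.G i →
      D.weights k i j = D.A₀ i j + ∑ l ∈ Finset.range k, D.increment l j := fun k i j hj => by
    induction k with
    | zero => simp [weights]
    | succ k ih => rw [weights_succ k i j hj, ih, Finset.sum_range_succ, add_assoc]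
  refine ⟨D.γ 0, (∑ i, ∑ j, |D.A₀ i j| + ∑' k, ∑ i, D.increment k i) + 1, h0, ?_,
    fun k i j hj => ?_⟩
  · have : 0 ≤ ∑' k, ∑ i, D.increment k i := tsum_nonneg hF0
    positivity
  · rw [hform k i j hj]
    have h1 : 0 ≤ ∑ l ∈ Finset.range k, D.increment l j :=
      Finset.sum_nonneg fun l _ => increment_nonneg hpos l j
    have h2 : ∑ l ∈ Finset.range k, D.increment l j ≤ ∑' k, ∑ i, D.increment k i :=
      (Finset.sum_le_sum fun l _ => Finset.single_le_sum
        (fun j _ => increment_nonneg hpos l j) (Finset.mem_univ j)).trans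
        (hsum.sum_le_tsum _ fun l _ => hF0 l)
    have h3 : D.A₀ i j ≤ ∑ i, ∑ j, |D.A₀ i j| :=
      (le_abs_self _).trans ((Finset.single_le_sum (f := fun j => |D.A₀ i j|)
        (fun _ _ => abs_nonneg _) (Finset.mem_univ j)).trans
        (Finset.single_le_sum (f := fun i => ∑ j, |D.A₀ i j|)
          (fun _ _ => by positivity) (Finset.mem_univ i)))
    obtain ⟨hcpos, hcA⟩ := (hc i j).1 hj
    have h4 : D.γ 0 ≤ D.A₀ i j := by
      rw [hcA]
      have : (1 : ℝ) ≤ c i j := by exact_mod_cast hcpos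
      nlinarith
    exact ⟨by linarith, by linarith⟩

end Input

/-! ### Almost supermartingales -/

lemma one_le_prod_one_add {ε : ℕ → ℝ} (hε : ∀ k, 0 ≤ ε k) (n : ℕ) :
    1 ≤ ∏ k ∈ Finset.range n, (1 + ε k) :=
  Finset.one_le_prod fun k _ => by simpa using hε k

lemma prod_one_add_le_exp {ε : ℕ → ℝ} (hε : ∀ k, 0 ≤ ε k) (hsum : Summable ε) (n : ℕ) :
    ∏ k ∈ Finset.range n, (1 + ε k) ≤ Real.exp (∑' k, ε k) := by
  calc ∏ k ∈ Finset.range n, (1 + ε k) ≤ ∏ k ∈ Finset.range n, Real.exp (ε k) :=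
        Finset.prod_le_prod (fun k _ => by linarith [hε k])
          fun k _ => by linarith [Real.add_one_le_exp (ε k)]
    _ = Real.exp (∑ k ∈ Finset.range n, ε k) := (Real.exp_sum _ _).symm
    _ ≤ _ := Real.exp_le_exp.2 (hsum.sum_le_tsum _ fun k _ => hε k)

/-- A perturbation of first order in the relative error `s` changes the `m`-th power by its linear
part up to an error of order `s ^ 2`. -/
lemma exists_add_pow_le (s₀ : ℝ) (hs₀ : 0 ≤ s₀) (m : ℕ) :
    ∃ C : ℝ, 0 ≤ C ∧ ∀ a ξ s : ℝ, 0 ≤ a → 0 ≤ s → s ≤ s₀ → |ξ| ≤ s * a → 0 ≤ a + ξ →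
      (a + ξ) ^ m ≤ a ^ m + m * a ^ (m - 1) * ξ + C * s ^ 2 * a ^ m := by
  induction m with
  | zero => exact ⟨0, le_rfl, fun a ξ s _ _ _ _ _ => by simp⟩
  | succ m ih =>
    obtain ⟨C, hC, h⟩ := ih
    refine ⟨m + C * (1 + s₀), by positivity, fun a ξ s ha hs hss hξ haξ => ?_⟩
    have h1 := mul_le_mul_of_nonneg_right (h a ξ s ha hs hss hξ haξ) haξ
    have hξ2 : ξ ^ 2 ≤ s ^ 2 * a ^ 2 := by
      rw [← mul_pow, ← sq_abs]; gcongr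
    have hξs : a + ξ ≤ (1 + s₀) * a := by
      nlinarith [le_abs_self ξ, mul_le_mul_of_nonneg_right hss ha]
    have h2 : C * s ^ 2 * a ^ m * (a + ξ) ≤ C * s ^ 2 * a ^ m * ((1 + s₀) * a) := by gcongr
    have h3 : m * a ^ (m - 1) * ξ ^ 2 ≤ m * s ^ 2 * a ^ (m + 1) := by
      rcases m with _ | m
      · simp
      · calc ((m + 1 : ℕ) : ℝ) * a ^ (m + 1 - 1) * ξ ^ 2
            ≤ ((m + 1 : ℕ) : ℝ) * a ^ (m + 1 - 1) * (s ^ 2 * a ^ 2) := by gcongr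
          _ = _ := by rw [Nat.add_sub_cancel]; ring
    have h4 : (m : ℝ) * a ^ (m - 1) * ξ * a = m * a ^ m * ξ := by
      rcases m with _ | m
      · simp
      · rw [Nat.add_sub_cancel]; ring
    rw [pow_succ, Nat.add_sub_cancel]
    push_cast
    calc (a + ξ) ^ m * (a + ξ)
        ≤ (a ^ m + m * a ^ (m - 1) * ξ + C * s ^ 2 * a ^ m) * (a + ξ) := h1
      _ = a ^ (m + 1) + (a ^ m * ξ + m * a ^ (m - 1) * ξ * a) + m * a ^ (m - 1) * ξ ^ 2
          + C * s ^ 2 * a ^ m * (a + ξ) := by ring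
      _ ≤ a ^ (m + 1) + (a ^ m * ξ + m * a ^ m * ξ) + m * s ^ 2 * a ^ (m + 1)
          + C * s ^ 2 * a ^ m * ((1 + s₀) * a) := by rw [h4]; linarith
      _ = _ := by ring

section Probability

variable {Ω : Type*} [mΩ : MeasurableSpace Ω] {P : Measure Ω} [IsProbabilityMeasure P]

lemma integral_mul_eq_zero_of_condExp {m : MeasurableSpace Ω} (hm : m ≤ mΩ) {H ξ : Ω → ℝ} {c : ℝ}
    (hH : StronglyMeasurable[m] H) (hHc : ∀ ω, |H ω| ≤ c) (hξ : Integrable ξ P)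
    (hξ0 : P[ξ | m] =ᵐ[P] 0) : ∫ ω, H ω * ξ ω ∂P = 0 := by
  have h1 : P[H * ξ | m] =ᵐ[P] 0 := by
    filter_upwards [condExp_stronglyMeasurable_mul_of_bound hm hH hξ c (.of_forall hHc), hξ0]
      with ω h2 h3
    simp [h2, h3]
  calc ∫ ω, H ω * ξ ω ∂P = ∫ ω, (P[H * ξ | m]) ω ∂P := (integral_condExp hm).symm
    _ = 0 := by rw [integral_congr_ae h1]; simp

variable {ℱ : Filtration ℕ mΩ} {R S ξ : ℕ → Ω → ℝ} {ε s : ℕ → ℝ}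

/-- The Robbins–Siegmund theorem: dividing by `∏ (1 + ε j)` and adding the accumulated `S`
turns the almost supermartingale `R` into a nonnegative supermartingale. -/
theorem ae_tendsto_and_summable_of_almost_supermartingale
    (hR : StronglyAdapted ℱ R) (hR0 : ∀ k ω, 0 ≤ R k ω) (hRi : ∀ k, Integrable (R k) P)
    (hS : StronglyAdapted ℱ S) (hS0 : ∀ k ω, 0 ≤ S k ω) (hSi : ∀ k, Integrable (S k) P)
    (hξi : ∀ k, Integrable (ξ k) P) (hξ0 : ∀ k, P[ξ k | ℱ k] =ᵐ[P] 0)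
    (hε : ∀ k, 0 ≤ ε k) (hεs : Summable ε)
    (hstep : ∀ k ω, R (k + 1) ω ≤ (1 + ε k) * R k ω - S k ω + ξ k ω) :
    ∀ᵐ ω ∂P, (∃ v, Tendsto (fun k => R k ω) atTop (𝓝 v)) ∧ Summable fun k => S k ω := by
  set π : ℕ → ℝ := fun n => ∏ k ∈ Finset.range n, (1 + ε k) with hπ
  have hπ1 : ∀ n, 1 ≤ π n := one_le_prod_one_add hε
  have hπ0 : ∀ n, 0 < π n := fun n => one_pos.trans_le (hπ1 n)
  have hπs : ∀ n, π (n + 1) = π n * (1 + ε n) := fun n => Finset.prod_range_succ _ _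
  have hπb : ∀ n, π n ≤ Real.exp (∑' k, ε k) := prod_one_add_le_exp hε hεs
  set X : ℕ → Ω → ℝ := fun n ω =>
    R n ω / π n + ∑ k ∈ Finset.range n, S k ω / π (k + 1) with hX
  have hX0 : ∀ n ω, 0 ≤ X n ω := fun n ω =>
    add_nonneg (div_nonneg (hR0 n ω) (hπ0 n).le)
      (Finset.sum_nonneg fun k _ => div_nonneg (hS0 k ω) (hπ0 _).le)
  have hXi : ∀ n, Integrable (X n) P := fun n =>
    ((hRi n).div_const _).add (integrable_finsetSum _ fun k _ => (hSi k).div_const _)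
  have hXa : StronglyAdapted ℱ X := fun n => by
    simp only [hX, div_eq_mul_inv]
    exact ((hR n).mul_const _).add (Finset.stronglyMeasurable_fun_sum _ fun k hk =>
      ((hS k).mono (ℱ.mono (Finset.mem_range.1 hk).le)).mul_const _)
  have hXstep : ∀ n ω, X (n + 1) ω ≤ X n ω + (π (n + 1))⁻¹ * ξ n ω := fun n ω => by
    simp only [hX, Finset.sum_range_succ]
    have h1 := div_le_div_of_nonneg_right (hstep n ω) (hπ0 (n + 1)).le
    have h2 : (1 + ε n) * R n ω / π (n + 1) = R n ω / π n := by
      rw [hπs, mul_comm (π n), mul_div_mul_left _ _ (by linarith [hε n])]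
    rw [add_div, sub_div, h2] at h1
    rw [inv_mul_eq_div]
    linarith
  have hsup : Supermartingale X ℱ P := by
    refine supermartingale_nat hXa hXi fun n => ?_
    have h1 : P[X (n + 1) | ℱ n] ≤ᵐ[P] P[X n + (π (n + 1))⁻¹ • ξ n | ℱ n] :=
      condExp_mono (hXi _) ((hXi n).add ((hξi n).smul _)) (.of_forall fun ω => hXstep n ω)
    have h2 := condExp_add (hXi n) ((hξi n).smul (π (n + 1))⁻¹) (ℱ n)
    have h3 := condExp_smul (μ := P) (π (n + 1))⁻¹ (ξ n) (ℱ n)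
    have h4 := condExp_of_stronglyMeasurable (ℱ.le n) (hXa n) (hXi n)
    filter_upwards [h1, h2, h3, hξ0 n] with ω g1 g2 g3 g4
    refine g1.trans (le_of_eq ?_)
    rw [g2, Pi.add_apply, g3, h4, Pi.smul_apply, g4]
    simp
  have hbdd : ∀ n, eLpNorm ((-X) n) 1 P ≤ ((∫ ω, X 0 ω ∂P).toNNReal : ENNReal) := fun n => by
    rw [Pi.neg_apply, eLpNorm_neg, eLpNorm_one_eq_lintegral_enorm,
      ← ofReal_integral_norm_eq_lintegral_enorm (hXi n)]
    refine ENNReal.ofReal_le_ofReal ?_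
    have h1 := hsup.setIntegral_le (Nat.zero_le n) MeasurableSet.univ
    simp only [Measure.restrict_univ] at h1
    calc ∫ ω, ‖X n ω‖ ∂P = ∫ ω, X n ω ∂P := by
          simp only [Real.norm_of_nonneg (hX0 n _)]
      _ ≤ _ := h1
  obtain ⟨π', hπ'⟩ : ∃ p, Tendsto π atTop (𝓝 p) :=
    ⟨_, tendsto_atTop_ciSup (monotone_nat_of_le_succ fun n => by
      rw [hπs]; exact le_mul_of_one_le_right (hπ0 n).le (by linarith [hε n]))
      ⟨_, Set.forall_mem_range.2 hπb⟩⟩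
  filter_upwards [hsup.neg.exists_ae_tendsto_of_bdd hbdd] with ω ⟨c, hc⟩
  have hXc : Tendsto (fun n => X n ω) atTop (𝓝 (-c)) := by simpa using hc.neg
  obtain ⟨B, hB⟩ := hXc.bddAbove_range
  have hsumm : Summable fun k => S k ω / π (k + 1) :=
    summable_of_sum_range_le (fun k => div_nonneg (hS0 k ω) (hπ0 _).le) (c := B) fun n => by
      have h1 : X n ω ≤ B := hB ⟨n, rfl⟩
      have h2 : 0 ≤ R n ω / π n := div_nonneg (hR0 n ω) (hπ0 n).le
      simp only [hX] at h1
      linarith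
  constructor
  · have h1 := (hXc.sub hsumm.hasSum.tendsto_sum_nat).mul hπ'
    refine ⟨_, h1.congr fun n => ?_⟩
    simp only [hX, add_sub_cancel_right]
    exact div_mul_cancel₀ _ (hπ0 n).ne'
  · refine Summable.of_nonneg_of_le (fun k => hS0 k ω) (fun k => ?_)
      (hsumm.mul_left (Real.exp (∑' k, ε k)))
    rw [mul_div_assoc', le_div_iff₀ (hπ0 _), mul_comm]
    exact mul_le_mul_of_nonneg_right (hπb _) (hS0 k ω)

/-- If the noise of an almost supermartingale has relative size `s k`, with `s` square-summable,
then all moments are bounded in time. -/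
theorem exists_integral_pow_le_of_almost_supermartingale
    (hR : StronglyAdapted ℱ R) (hR0 : ∀ k ω, 0 ≤ R k ω) (hRb : ∀ k, ∃ c, ∀ ω, R k ω ≤ c)
    (hξi : ∀ k, Integrable (ξ k) P) (hξ0 : ∀ k, P[ξ k | ℱ k] =ᵐ[P] 0)
    (hε : ∀ k, 0 ≤ ε k) (hεs : Summable ε) (hs : ∀ k, 0 ≤ s k) (hss : Summable fun k => s k ^ 2)
    (hξs : ∀ k ω, |ξ k ω| ≤ s k * R k ω)
    (hstep : ∀ k ω, R (k + 1) ω ≤ (1 + ε k) * R k ω + ξ k ω) (m : ℕ) :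
    ∃ C, ∀ k, ∫ ω, R k ω ^ m ∂P ≤ C := by
  obtain ⟨s₀, hs₀⟩ : ∃ s₀, ∀ k, s k ≤ s₀ := by
    refine ⟨1 + ∑' k, s k ^ 2, fun k => ?_⟩
    have := hss.le_tsum k fun j _ => sq_nonneg (s j)
    nlinarith [sq_nonneg (s k - 1), hs k]
  obtain ⟨C, hC, hpow⟩ := exists_add_pow_le s₀ ((hs 0).trans (hs₀ 0)) m
  have hint : ∀ k n, Integrable (fun ω => R k ω ^ n) P := fun k n => by
    obtain ⟨c, hc⟩ := hRb k
    refine Integrable.of_bound (((hR k).mono (ℱ.le k)).pow n).aestronglyMeasurable (c ^ n)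
      (.of_forall fun ω => ?_)
    rw [Real.norm_of_nonneg (pow_nonneg (hR0 k ω) n)]
    exact pow_le_pow_left₀ (hR0 k ω) (hc ω) n
  have hone : ∀ k, ∫ ω, R (k + 1) ω ^ m ∂P
      ≤ ((C * s k ^ 2 + 1) * (1 + ε k) ^ m) * ∫ ω, R k ω ^ m ∂P := fun k => by
    have hε1 : 1 ≤ 1 + ε k := by linarith [hε k]
    have hbound : ∀ ω, R (k + 1) ω ^ m ≤ (C * s k ^ 2 + 1) * (1 + ε k) ^ m * R k ω ^ m
        + (m * ((1 + ε k) * R k ω) ^ (m - 1)) * ξ k ω := fun ω => by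
      have h0 : 0 ≤ (1 + ε k) * R k ω := mul_nonneg (by linarith) (hR0 k ω)
      have h1 := hstep k ω
      have h2 : |ξ k ω| ≤ s k * ((1 + ε k) * R k ω) :=
        (hξs k ω).trans (mul_le_mul_of_nonneg_left
          (le_mul_of_one_le_left (hR0 k ω) hε1) (hs k))
      have h3 := hpow _ _ _ h0 (hs k) (hs₀ k) h2 ((hR0 _ _).trans h1)
      have h4 := pow_le_pow_left₀ (hR0 (k + 1) ω) h1 m
      have h5 := mul_pow (1 + ε k) (R k ω) m
      rw [h5] at h3
      linarith
    obtain ⟨c, hc⟩ := hRb k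
    have hHm : StronglyMeasurable[ℱ k] fun ω => m * ((1 + ε k) * R k ω) ^ (m - 1) :=
      (((hR k).const_mul (1 + ε k)).pow (m - 1)).const_mul (m : ℝ)
    have hHb : ∀ ω, |m * ((1 + ε k) * R k ω) ^ (m - 1)| ≤ m * ((1 + ε k) * c) ^ (m - 1) :=
      fun ω => by
        have := hR0 k ω
        have := hc ω
        rw [abs_of_nonneg (by positivity)]
        gcongr
    have hz := integral_mul_eq_zero_of_condExp (ℱ.le k) hHm hHb (hξi k) (hξ0 k)
    have hHi : Integrable (fun ω => m * ((1 + ε k) * R k ω) ^ (m - 1) * ξ k ω) P :=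
      (hξi k).bdd_mul (hHm.mono (ℱ.le k)).aestronglyMeasurable (.of_forall hHb)
    have h6 := integral_mono (hint (k + 1) m)
      (((hint k m).const_mul ((C * s k ^ 2 + 1) * (1 + ε k) ^ m)).add hHi) hbound
    simp only [Pi.add_apply] at h6
    rwa [integral_add ((hint k m).const_mul _) hHi, hz, integral_const_mul, add_zero] at h6
  set η : ℕ → ℝ := fun k => C * s k ^ 2 + m * ε k with hη
  have hηs : Summable η := (hss.mul_left C).add (hεs.mul_left _)
  have hnn : ∀ k, 0 ≤ ∫ ω, R k ω ^ m ∂P := fun k =>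
    integral_nonneg fun ω => pow_nonneg (hR0 k ω) m
  have hexp : ∀ k, ∫ ω, R k ω ^ m ∂P
      ≤ Real.exp (∑ j ∈ Finset.range k, η j) * ∫ ω, R 0 ω ^ m ∂P := fun k => by
    induction k with
    | zero => simp
    | succ k ih =>
      have h1 : (C * s k ^ 2 + 1) * (1 + ε k) ^ m ≤ Real.exp (η k) := by
        rw [hη, Real.exp_add, Real.exp_nat_mul]
        have := hε k
        gcongr
        · exact Real.add_one_le_exp _
        · linarith [Real.add_one_le_exp (ε k)]
      calc _ ≤ _ := hone k
        _ ≤ Real.exp (η k) * ∫ ω, R k ω ^ m ∂P := mul_le_mul_of_nonneg_right h1 (hnn k)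
        _ ≤ Real.exp (η k) * (Real.exp (∑ j ∈ Finset.range k, η j) * ∫ ω, R 0 ω ^ m ∂P) := by
            gcongr
        _ = _ := by rw [Finset.sum_range_succ, Real.exp_add (∑ j ∈ Finset.range k, η j)]; ring
  refine ⟨Real.exp (∑' k, η k) * ∫ ω, R 0 ω ^ m ∂P, fun k => (hexp k).trans ?_⟩
  refine mul_le_mul_of_nonneg_right (Real.exp_le_exp.2 (hηs.sum_le_tsum _ fun j _ => ?_)) (hnn 0)
  have := hε j
  positivity

/-- Almost sure convergence to zero and bounded second moments give convergence in mean: the part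
above the level `L` contributes at most `C / L`. -/
lemma tendsto_integral_zero_of_sq_bounded {Y : ℕ → Ω → ℝ} (hY : ∀ k, AEStronglyMeasurable (Y k) P)
    (hY0 : ∀ k ω, 0 ≤ Y k ω) (hYi : ∀ k, Integrable (fun ω => Y k ω ^ 2) P) {C : ℝ}
    (hC : ∀ k, ∫ ω, Y k ω ^ 2 ∂P ≤ C) (hlim : ∀ᵐ ω ∂P, Tendsto (fun k => Y k ω) atTop (𝓝 0)) :
    Tendsto (fun k => ∫ ω, Y k ω ∂P) atTop (𝓝 0) := by
  have hC0 : 0 ≤ C := (integral_nonneg fun ω => sq_nonneg _).trans (hC 0)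
  refine tendsto_order.2 ⟨fun a ha => .of_forall fun k =>
    ha.trans_le (integral_nonneg (hY0 k)), fun a ha => ?_⟩
  obtain ⟨L, hL0, hL⟩ : ∃ L : ℝ, 0 < L ∧ C / L < a / 2 := by
    refine ⟨(C + 1) / (a / 2), by positivity, ?_⟩
    rw [div_div_eq_mul_div, div_lt_iff₀ (by positivity)]
    nlinarith
  have hmeas : ∀ k, AEStronglyMeasurable (fun ω => min (Y k ω) L) P := fun k =>
    (hY k).inf aestronglyMeasurable_const
  have hbd : ∀ k ω, ‖min (Y k ω) L‖ ≤ L := fun k ω => by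
    rw [Real.norm_of_nonneg (le_min (hY0 k ω) hL0.le)]; exact min_le_right _ _
  have htr : Tendsto (fun k => ∫ ω, min (Y k ω) L ∂P) atTop (𝓝 (∫ _, (0 : ℝ) ∂P)) := by
    refine tendsto_integral_of_dominated_convergence (fun _ => L) hmeas (integrable_const L)
      (fun k => .of_forall (hbd k)) ?_
    filter_upwards [hlim] with ω hω
    simpa [hL0.le] using hω.min (tendsto_const_nhds (x := L))
  rw [integral_zero] at htr
  filter_upwards [(tendsto_order.1 htr).2 (a / 2) (by positivity)] with k hk
  have hi : Integrable (fun ω => min (Y k ω) L) P :=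
    Integrable.of_bound (hmeas k) L (.of_forall (hbd k))
  have h1 : ∫ ω, Y k ω ∂P ≤ ∫ ω, (min (Y k ω) L + Y k ω ^ 2 / L) ∂P := by
    refine integral_mono_of_nonneg (.of_forall (hY0 k)) (hi.add ((hYi k).div_const L))
      (.of_forall fun ω => ?_)
    have := hY0 k ω
    rcases le_total (Y k ω) L with h | h
    · simp only [min_eq_left h]
      have : 0 ≤ Y k ω ^ 2 / L := by positivity
      linarith
    · have : Y k ω ≤ Y k ω ^ 2 / L := by rw [le_div_iff₀ hL0]; nlinarith
      have := le_min (hY0 k ω) hL0.le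
      simp only
      linarith
  rw [integral_add hi ((hYi k).div_const L), integral_div] at h1
  have h2 : (∫ ω, Y k ω ^ 2 ∂P) / L ≤ C / L := by gcongr; exact hC k
  linarith

end Probability

variable {V : Type*} [Fintype V]

/-! ### The Laplacian and the drift of the squared distance -/

/-- The out-degree Laplacian of the weighted digraph. Its columns sum to zero; applied to the
constant vector `1`, it gives minus the weight balance. -/
noncomputable def laplacian (G : Digraph V) (A : Matrix V V ℝ) (x : V → ℝ) (i : V) : ℝ :=
  outFlow G A i * x i - ∑ j ∈ inNeighbors G i, A i j * x j

lemma sum_mul_tail (G : Digraph V) (A : Matrix V V ℝ) (f : V → ℝ) :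
    ∑ i, ∑ j ∈ inNeighbors G i, A i j * f j = ∑ i, outFlow G A i * f i := by
  rw [sum_inNeighbors_comm G fun i j => A i j * f j]
  simp only [outFlow, Finset.sum_mul]

lemma sum_mul_head (G : Digraph V) (A : Matrix V V ℝ) (f : V → ℝ) :
    ∑ i, ∑ j ∈ inNeighbors G i, A i j * f i = ∑ i, inFlow G A i * f i := by
  simp only [inFlow, Finset.sum_mul]

lemma sum_laplacian (G : Digraph V) (A : Matrix V V ℝ) (x : V → ℝ) :
    ∑ i, laplacian G A x i = 0 := by
  simp only [laplacian, Finset.sum_sub_distrib, sum_mul_tail, sub_self]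

lemma laplacian_add (G : Digraph V) (A : Matrix V V ℝ) (x y : V → ℝ) (i : V) :
    laplacian G A (fun i => x i + y i) i = laplacian G A x i + laplacian G A y i := by
  simp only [laplacian, mul_add, Finset.sum_add_distrib]
  ring

lemma laplacian_const (G : Digraph V) (A : Matrix V V ℝ) (c : ℝ) (i : V) :
    laplacian G A (fun _ => c) i = -(c * balance G A i) := by
  rw [laplacian, ← Finset.sum_mul, balance, inFlow]
  ring

/-- The transpose of the Laplacian. -/
lemma sum_mul_laplacian (G : Digraph V) (A : Matrix V V ℝ) (z x : V → ℝ) :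
    ∑ i, z i * laplacian G A x i
      = ∑ j, (outFlow G A j * z j - ∑ i ∈ outNeighbors G j, A i j * z i) * x j := by
  have h := sum_inNeighbors_comm G fun i j => z i * (A i j * x j)
  simp only [laplacian, mul_sub, sub_mul, Finset.sum_sub_distrib, Finset.mul_sum, Finset.sum_mul]
  rw [h]
  congr 1
  · exact Finset.sum_congr rfl fun i _ => by ring
  · exact Finset.sum_congr rfl fun i _ => Finset.sum_congr rfl fun j _ => by ring

lemma abs_laplacian_le {G : Digraph V} {A : Matrix V V ℝ} {M Q : ℝ} (hM : 0 ≤ M) {x : V → ℝ}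
    (hA : ∀ i j, j ∈ inNeighbors G i → |A i j| ≤ M) (hx : ∀ i, |x i| ≤ Q) (i : V) :
    |laplacian G A x i| ≤ 2 * (Fintype.card V * (M * Q)) := by
  have hQ : 0 ≤ Q := (abs_nonneg _).trans (hx i)
  have h1 : |outFlow G A i * x i| ≤ Fintype.card V * (M * Q) := by
    rw [outFlow, Finset.sum_mul]
    calc _ ≤ ∑ j ∈ outNeighbors G i, |A j i * x i| := Finset.abs_sum_le_sum_abs _ _
      _ ≤ (outNeighbors G i).card • (M * Q) := Finset.sum_le_card_nsmul _ _ _ fun j hj => by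
          rw [abs_mul]
          exact mul_le_mul (hA j i (by simpa using hj)) (hx i) (abs_nonneg _) hM
      _ ≤ _ := by
          rw [nsmul_eq_mul]
          gcongr
          exact Finset.card_le_univ _
  have h2 : |∑ j ∈ inNeighbors G i, A i j * x j| ≤ Fintype.card V * (M * Q) := by
    calc _ ≤ ∑ j ∈ inNeighbors G i, |A i j * x j| := Finset.abs_sum_le_sum_abs _ _
      _ ≤ (inNeighbors G i).card • (M * Q) := Finset.sum_le_card_nsmul _ _ _ fun j hj => by
          rw [abs_mul]
          exact mul_le_mul (hA i j hj) (hx j) (abs_nonneg _) hM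
      _ ≤ _ := by
          rw [nsmul_eq_mul]
          gcongr
          exact Finset.card_le_univ _
  rw [abs_le] at h1 h2 ⊢
  rw [laplacian]
  constructor <;> linarith

/-- Let `w` be obtained from `z` by projecting each entry to an interval that contains `0`. As
`w` is the derivative of the convex function `g = z w - w ^ 2 / 2` of `z`, the form `z ⬝ L w`
controls the differences of `w` along the edges, up to an error that comes from the lack of balance
of the weights. -/
lemma le_sum_mul_laplacian {G : Digraph V} {A : Matrix V V ℝ} {a : ℝ}
    (ha : ∀ i j, j ∈ inNeighbors G i → a ≤ A i j ∧ 0 ≤ A i j) {z w : V → ℝ}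
    (hzw : ∀ i j, 0 ≤ (z i - w i) * (w i - w j)) (hzw0 : ∀ i, 0 ≤ (z i - w i) * w i) :
    a / 2 * ∑ i, ∑ j ∈ inNeighbors G i, (w i - w j) ^ 2
      - (∑ i, |balance G A i|) * (∑ i, z i ^ 2) / 2 ≤ ∑ i, z i * laplacian G A w i := by
  set g : V → ℝ := fun i => z i * w i - w i ^ 2 / 2 with hg
  have h1 : ∑ i, z i * laplacian G A w i
      = ∑ i, ∑ j ∈ inNeighbors G i, A i j * ((z j - z i) * w j) := by
    have h := sum_mul_tail G A fun j => z j * w j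
    have h' : ∑ i, z i * laplacian G A w i = ∑ i, outFlow G A i * (z i * w i)
        - ∑ i, ∑ j ∈ inNeighbors G i, A i j * (z i * w j) := by
      simp only [laplacian, mul_sub, Finset.sum_sub_distrib, Finset.mul_sum]
      congr 1
      · exact Finset.sum_congr rfl fun i _ => by ring
      · exact Finset.sum_congr rfl fun i _ => Finset.sum_congr rfl fun j _ => by ring
    rw [h', ← h]
    simp only [← Finset.sum_sub_distrib]
    exact Finset.sum_congr rfl fun i _ => Finset.sum_congr rfl fun j _ => by ring
  have h2 : ∑ i, ∑ j ∈ inNeighbors G i, A i j * (g j - g i) = -∑ i, balance G A i * g i := by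
    simp only [mul_sub, Finset.sum_sub_distrib]
    rw [sum_mul_tail, sum_mul_head]
    simp only [balance, sub_mul, Finset.sum_sub_distrib]
    ring
  have h3 : ∑ i, balance G A i * g i ≤ (∑ i, |balance G A i|) * (∑ i, z i ^ 2) / 2 := by
    rw [mul_div_assoc, Finset.sum_mul]
    refine Finset.sum_le_sum fun i _ => ?_
    have hg0 : 0 ≤ g i := by simp only [hg]; nlinarith [hzw0 i, sq_nonneg (w i)]
    have hgz : g i ≤ z i ^ 2 / 2 := by simp only [hg]; nlinarith [sq_nonneg (z i - w i)]
    have hz : z i ^ 2 ≤ ∑ i, z i ^ 2 :=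
      Finset.single_le_sum (f := fun i => z i ^ 2) (fun _ _ => sq_nonneg _) (Finset.mem_univ i)
    calc balance G A i * g i ≤ |balance G A i| * g i :=
          mul_le_mul_of_nonneg_right (le_abs_self _) hg0
      _ ≤ |balance G A i| * ((∑ i, z i ^ 2) / 2) := by gcongr; linarith
  have h4 : ∑ i, ∑ j ∈ inNeighbors G i, (A i j * (g j - g i) + a / 2 * (w i - w j) ^ 2)
      ≤ ∑ i, ∑ j ∈ inNeighbors G i, A i j * ((z j - z i) * w j) := by
    refine Finset.sum_le_sum fun i _ => Finset.sum_le_sum fun j hj => ?_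
    obtain ⟨haA, hA0⟩ := ha i j hj
    have h5 : g j - g i + (w i - w j) ^ 2 / 2 ≤ (z j - z i) * w j := by
      simp only [hg]; nlinarith [hzw i j]
    have h6 := mul_le_mul_of_nonneg_left h5 hA0
    have h7 := mul_le_mul_of_nonneg_right haA (sq_nonneg (w i - w j))
    linarith
  simp only [Finset.sum_add_distrib, ← Finset.mul_sum] at h4
  rw [h1]
  linarith

namespace Input

/-! ### The quantizer -/

section Quantizer

variable {U : Type*} {D : Input U}

lemma qmin_le_clip (hq : D.qmin < D.qmax) (y : ℝ) : D.qmin ≤ D.clip y :=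
  le_min (le_max_right _ _) hq.le

lemma clip_le_qmax (y : ℝ) : D.clip y ≤ D.qmax := min_le_right _ _

/-- Clipping is the projection to the quantization range. -/
lemma sub_clip_mul_nonneg (hq : D.qmin < D.qmax) {x : ℝ} (hx : x ∈ Set.Icc D.qmin D.qmax)
    (y : ℝ) : 0 ≤ (y - D.clip y) * (D.clip y - x) := by
  obtain ⟨h1, h2⟩ := hx
  rcases le_total y D.qmin with h | h
  · have : D.clip y = D.qmin := by rw [clip, max_eq_right h, min_eq_left hq.le]
    rw [this]; nlinarith
  · rcases le_total y D.qmax with h' | h'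
    · have : D.clip y = y := by rw [clip, max_eq_left h, min_eq_left h']
      simp [this]
    · have : D.clip y = D.qmax := by rw [clip, max_eq_left h, min_eq_right h']
      rw [this]; nlinarith

lemma cell_pos (hq : D.qmin < D.qmax) {B : ℕ} (hB : 0 < B) : 0 < D.cell B := by
  have : (2 : ℝ) ≤ 2 ^ B := le_self_pow₀ one_le_two hB.ne'
  exact div_pos (by linarith) (by linarith)

lemma cell_le (hq : D.qmin < D.qmax) {B : ℕ} (hB : 0 < B) : D.cell B ≤ D.qmax - D.qmin := by
  have : (2 : ℝ) ≤ 2 ^ B := le_self_pow₀ one_le_two hB.ne'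
  exact div_le_self (by linarith) (by linarith)

/-- The quantization error at the value `y`: it vanishes if nothing is transmitted. -/
noncomputable def quantizationError (D : Input U) (B : ℕ) (y : ℝ) (up : Prop) : ℝ :=
  if B = 0 then 0 else D.quantize B y up - D.clip y

open Classical in
/-- The quantization error is a multiple of the deviation of the rounding choice from its mean. The
factor `⌈u⌉ - ⌊u⌋` matters when the position `u` is an integer: then the choice has no effect. -/
lemma quantizationError_eq (hq : D.qmin < D.qmax) {B : ℕ} (hB : 0 < B) (y : ℝ) (up : Prop) :
    D.quantizationError B y up = D.cell B * (⌈D.position B y⌉ - ⌊D.position B y⌋)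
      * ((if up then 1 else 0) - D.roundUpProb B y) := by
  have hc := (cell_pos hq hB).ne'
  have hclip : D.clip y = D.qmin + D.position B y * D.cell B := by
    rw [position, div_mul_cancel₀ _ hc]; ring
  rw [quantizationError, if_neg hB.ne', quantize, if_neg hB.ne', hclip, roundUpProb]
  set u := D.position B y
  rcases eq_or_ne (⌊u⌋ : ℝ) u with h | h
  · have h2 : (⌈u⌉ : ℝ) = u := by rw [← h, Int.ceil_intCast]
    split_ifs <;> rw [h, h2] <;> ring
  · have h1 : ⌈u⌉ = ⌊u⌋ + 1 := by
      have hlt : (⌊u⌋ : ℝ) < u := lt_of_le_of_ne (Int.floor_le u) h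
      refine Int.ceil_eq_iff.2 ⟨by push_cast; linarith, ?_⟩
      push_cast
      exact (Int.lt_floor_add_one u).le
    split_ifs <;> rw [h1] <;> push_cast <;> ring

lemma ceil_sub_floor_mem (u : ℝ) : (⌈u⌉ : ℝ) - ⌊u⌋ ∈ Set.Icc (0 : ℝ) 1 := by
  have h1 : ⌊u⌋ ≤ ⌈u⌉ := Int.floor_le_ceil u
  have h2 : ⌈u⌉ ≤ ⌊u⌋ + 1 := Int.ceil_le_floor_add_one u
  have h1' : (⌊u⌋ : ℝ) ≤ ⌈u⌉ := by exact_mod_cast h1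
  have h2' : (⌈u⌉ : ℝ) ≤ ⌊u⌋ + 1 := by exact_mod_cast h2
  exact ⟨by linarith, by linarith⟩

lemma roundUpProb_mem (B : ℕ) (y : ℝ) : D.roundUpProb B y ∈ Set.Icc (0 : ℝ) 1 :=
  ⟨sub_nonneg.2 (Int.floor_le _), by
    have := Int.lt_floor_add_one (D.position B y)
    rw [roundUpProb]; linarith⟩

lemma abs_quantizationError_le (hq : D.qmin < D.qmax) (B : ℕ) (y : ℝ) (up : Prop) :
    |D.quantizationError B y up| ≤ D.qmax - D.qmin := by
  classical
  rcases Nat.eq_zero_or_pos B with rfl | hB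
  · simpa [quantizationError] using hq.le
  · rw [quantizationError_eq hq hB, abs_mul, abs_mul, abs_of_pos (cell_pos hq hB)]
    obtain ⟨h1, h2⟩ := ceil_sub_floor_mem (D.position B y)
    obtain ⟨h3, h4⟩ := roundUpProb_mem (D := D) B y
    have h5 : |(if up then (1 : ℝ) else 0) - D.roundUpProb B y| ≤ 1 := by
      rw [abs_le]; split_ifs <;> constructor <;> linarith
    rw [abs_of_nonneg h1]
    calc _ ≤ (D.qmax - D.qmin) * 1 * 1 :=
          mul_le_mul (mul_le_mul (cell_le hq hB) h2 h1 (by linarith)) h5 (abs_nonneg _)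
            (by linarith)
      _ = _ := by ring

lemma measurable_clip : Measurable D.clip :=
  (measurable_id.max measurable_const).min measurable_const

lemma measurable_position (B : ℕ) : Measurable (D.position B) :=
  (measurable_clip.sub_const _).div_const _

lemma measurable_ceil_position (B : ℕ) : Measurable fun y => (⌈D.position B y⌉ : ℝ) :=
  (measurable_from_top (f := fun n : ℤ => (n : ℝ))).comp (measurable_position B).ceil

lemma measurable_floor_position (B : ℕ) : Measurable fun y => (⌊D.position B y⌋ : ℝ) :=
  (measurable_from_top (f := fun n : ℤ => (n : ℝ))).comp (measurable_position B).floor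

lemma measurable_quantize {Ω : Type*} {m : MeasurableSpace Ω} {B : ℕ} {f : Ω → ℝ}
    (hf : Measurable[m] f) {s : Set Ω} (hs : 0 < B → MeasurableSet[m] s) :
    Measurable[m] fun ω => D.quantize B (f ω) (ω ∈ s) := by
  classical
  rcases Nat.eq_zero_or_pos B with rfl | hB
  · simp only [quantize, if_true]
    exact measurable_const
  · simp only [quantize, if_neg hB.ne']
    refine Measurable.ite (hs hB) ?_ ?_
    · exact (((measurable_ceil_position B).comp hf).mul_const _).const_add _
    · exact (((measurable_floor_position B).comp hf).mul_const _).const_add _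

/-- All nodes transmit at time `k`, or none does. -/
def Synchronous (D : Input U) (k : ℕ) : Prop := (∀ i, 0 < D.Bc k i) ∨ ∀ i, D.Bc k i = 0

lemma ConsensusBits.synchronous (hBc : D.ConsensusBits) (k : ℕ) : D.Synchronous k := by
  obtain ⟨W, -, B, hB, -, hBB⟩ := hBc
  rcases hB k with h | h
  · exact Or.inr fun i => (hBB k i).2 h
  · refine Or.inl fun i => ?_
    have := (hBB k i).1 (by omega)
    omega

end Quantizer

variable {D : Input V} {Ω : Type*} {up : ℕ → V → Set Ω}

/-! ### One step of the consensus iteration -/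

/-- The sum of the squared differences of the clipped values along the edges. -/
noncomputable def disagreement (D : Input V) (y : V → ℝ) : ℝ :=
  ∑ i, ∑ j ∈ inNeighbors D.G i, (D.clip (y i) - D.clip (y j)) ^ 2

open Classical in
/-- The decrease of the squared distance at time `k`, up to a constant factor. -/
noncomputable def dissipation (D : Input V) (up : ℕ → V → Set Ω) (k : ℕ) (ω : Ω) : ℝ :=
  if ∀ i, 0 < D.Bc k i then D.α k * D.disagreement (D.estimate up k ω) else 0

/-- One plus the squared distance of the estimates from the average. -/
noncomputable def energy (D : Input V) (up : ℕ → V → Set Ω) (k : ℕ) (ω : Ω) : ℝ :=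
  1 + ‖D.estimate up k ω - D.averageVector‖ ^ 2

/-- The part of the change of the energy that is linear in the quantization errors. -/
noncomputable def noise (D : Input V) (up : ℕ → V → Set Ω) (k : ℕ) (ω : Ω) : ℝ :=
  -2 * D.α k * ∑ i, (D.estimate up k ω i - D.average) * laplacian D.G (D.weights k)
    (fun i => D.quantizationError (D.Bc k i) (D.estimate up k ω i) (ω ∈ up k i)) i

lemma energy_eq (k : ℕ) (ω : Ω) :
    D.energy up k ω = 1 + ∑ i, (D.estimate up k ω i - D.average) ^ 2 := by
  rw [energy, EuclideanSpace.real_norm_sq_eq]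
  simp [averageVector]

lemma estimate_succ (k : ℕ) (ω : Ω) (i : V) :
    D.estimate up (k + 1) ω i = D.estimate up k ω i - D.α k * laplacian D.G (D.weights k)
      (fun i => D.quantize (D.Bc k i) (D.estimate up k ω i) (ω ∈ up k i)) i := by
  simp only [estimate, laplacian, balance, inFlow, mul_sub, Finset.sum_sub_distrib,
    ← Finset.sum_mul]
  ring

lemma sum_estimate (k : ℕ) (ω : Ω) : ∑ i, D.estimate up k ω i = ∑ i, D.y₀ i := by
  induction k with
  | zero => rfl
  | succ k ih =>
    simp only [estimate_succ, Finset.sum_sub_distrib, ← Finset.mul_sum, sum_laplacian, mul_zero,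
      sub_zero, ih]

lemma sum_estimate_sub_average [Nonempty V] (k : ℕ) (ω : Ω) :
    ∑ i, (D.estimate up k ω i - D.average) = 0 := by
  rw [Finset.sum_sub_distrib, sum_estimate, average, Finset.sum_const, nsmul_eq_mul,
    Finset.card_univ, mul_div_cancel₀ _ (by simp), sub_self]

lemma disagreement_nonneg (y : V → ℝ) : 0 ≤ D.disagreement y :=
  Finset.sum_nonneg fun _ _ => Finset.sum_nonneg fun _ _ => sq_nonneg _

lemma two_mul_abs_le (t : ℝ) : 2 * |t| ≤ 1 + t ^ 2 := by
  nlinarith [sq_nonneg (|t| - 1), sq_abs t]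

lemma one_le_energy (k : ℕ) (ω : Ω) : 1 ≤ D.energy up k ω := by
  rw [energy]; linarith [sq_nonneg ‖D.estimate up k ω - D.averageVector‖]

lemma abs_estimate_sub_average_le (k : ℕ) (ω : Ω) (i : V) :
    |D.estimate up k ω i - D.average| ≤ D.energy up k ω := by
  have h1 := two_mul_abs_le (D.estimate up k ω i - D.average)
  have h2 := Finset.single_le_sum (f := fun i => (D.estimate up k ω i - D.average) ^ 2)
    (fun _ _ => sq_nonneg _) (Finset.mem_univ i)
  have h3 := abs_nonneg (D.estimate up k ω i - D.average)
  rw [energy_eq]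
  linarith

/-- Pathwise, the energy is an almost supermartingale up to the noise. The perturbations are
`α ∑ |b_i|`, from the lack of balance, and `α ^ 2`, from the quadratic term of the step; the noise
is of order `α` relative to the energy. The constant `C` does not depend on the rounding choices. -/
lemma exists_energy_succ_le (hq : D.qmin < D.qmax) (havg : D.InformativeAverage)
    (hα0 : ∀ k, 0 < D.α k) (hsync : ∀ k, D.Synchronous k) {a M : ℝ} (ha : 0 < a)
    (hweights : ∀ k i j, j ∈ inNeighbors D.G i → a ≤ D.weights k i j ∧ D.weights k i j ≤ M) :
    ∃ C : ℝ, 0 ≤ C ∧ ∀ (up : ℕ → V → Set Ω) k ω,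
      |D.noise up k ω| ≤ C * D.α k * D.energy up k ω ∧
      D.energy up (k + 1) ω ≤ (1 + ((1 + |D.average|)
        * (D.α k * ∑ i, |balance D.G (D.weights k) i|) + C * D.α k ^ 2)) * D.energy up k ω
        - a * D.dissipation up k ω + D.noise up k ω := by
  set N : ℝ := (Fintype.card V : ℝ) with hN
  set M' := max M 0
  set Q : ℝ := 2 * (|D.qmin| + |D.qmax|) with hQ
  set K : ℝ := 2 * (N * (M' * Q)) with hK
  have hM' : 0 ≤ M' := le_max_right _ _
  have hQ0 : 0 ≤ Q := by positivity
  have hN0 : 0 ≤ N := by positivity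
  have hK0 : 0 ≤ K := by positivity
  have habs : ∀ k i j, j ∈ inNeighbors D.G i → |D.weights k i j| ≤ M' := fun k i j h => by
    obtain ⟨h1, h2⟩ := hweights k i j h
    rw [abs_of_nonneg (by linarith)]
    exact h2.trans (le_max_left _ _)
  have hqQ : D.qmax - D.qmin ≤ |D.qmin| + |D.qmax| := by
    linarith [neg_abs_le D.qmin, le_abs_self D.qmax]
  have hQ2 : |D.qmin| + |D.qmax| ≤ Q := by
    linarith [abs_nonneg D.qmin, abs_nonneg D.qmax]
  obtain ⟨C, hC1, hC2⟩ : ∃ C, N * K ^ 2 ≤ C ∧ (N + 1) * K ≤ C :=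
    ⟨_, le_max_left _ _, le_max_right _ _⟩
  have hC0 : 0 ≤ C := le_trans (by positivity) hC1
  refine ⟨C, hC0, fun up k ω => ?_⟩
  have hα := hα0 k
  set y : V → ℝ := fun i => D.estimate up k ω i with hy
  set z : V → ℝ := fun i => y i - D.average with hz
  set w : V → ℝ := fun i => D.clip (y i) - D.average with hw
  set e : V → ℝ := fun i => D.quantizationError (D.Bc k i) (y i) (ω ∈ up k i) with he
  set x : V → ℝ := fun i => D.quantize (D.Bc k i) (y i) (ω ∈ up k i) with hx
  set b : V → ℝ := fun i => balance D.G (D.weights k) i with hb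
  set L : (V → ℝ) → V → ℝ := laplacian D.G (D.weights k) with hL
  set E := D.energy up k ω with hE
  have hEz : E = 1 + ∑ i, z i ^ 2 := energy_eq k ω
  have hZ : 0 ≤ ∑ i, z i ^ 2 := Finset.sum_nonneg fun i _ => sq_nonneg (z i)
  have hE1 : 1 ≤ E := by linarith
  have hE0 : 0 ≤ E := by linarith
  have hβ : 0 ≤ ∑ i, |b i| := by positivity
  have hnoise : D.noise up k ω = -2 * D.α k * ∑ i, z i * L e i := rfl
  have hzE : 2 * ∑ i, |z i| ≤ (N + 1) * E := by
    have h1 : ∑ i, 2 * |z i| ≤ ∑ i, (1 + z i ^ 2) := Finset.sum_le_sum fun i _ =>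
      two_mul_abs_le (z i)
    rw [← Finset.mul_sum, Finset.sum_add_distrib, Finset.sum_const, Finset.card_univ,
      nsmul_eq_mul, mul_one] at h1
    have h2 := mul_nonneg hN0 hZ
    rw [hEz]
    linarith
  have hLe : ∀ i, |L e i| ≤ K := abs_laplacian_le hM' (habs k) fun i =>
    (abs_quantizationError_le hq _ _ _).trans (hqQ.trans hQ2)
  refine ⟨?_, ?_⟩
  · have h1 : |∑ i, z i * L e i| ≤ (∑ i, |z i|) * K := by
      rw [Finset.sum_mul]
      refine (Finset.abs_sum_le_sum_abs _ _).trans (Finset.sum_le_sum fun i _ => ?_)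
      rw [abs_mul]
      exact mul_le_mul_of_nonneg_left (hLe i) (abs_nonneg _)
    have h2 := mul_le_mul_of_nonneg_right hzE hK0
    have h3 := mul_le_mul_of_nonneg_right hC2 hE0
    have h4 : 2 * |∑ i, z i * L e i| ≤ C * E := by linarith
    rw [hnoise, abs_mul, abs_mul, abs_of_pos hα, abs_neg, abs_two]
    calc 2 * D.α k * |∑ i, z i * L e i| = D.α k * (2 * |∑ i, z i * L e i|) := by ring
      _ ≤ D.α k * (C * E) := mul_le_mul_of_nonneg_left h4 hα.le
      _ = _ := by ring
  rcases hsync k with hB | hB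
  · have hxe : x = fun i => (w i + D.average) + e i := by
      funext i
      simp only [hx, hw, he, quantizationError, if_neg (hB i).ne']
      ring
    have hLx : ∀ i, L x i = L w i - D.average * b i + L e i := fun i => by
      rw [hxe, hL, laplacian_add, laplacian_add, laplacian_const]; ring
    have hxQ : ∀ i, |x i| ≤ Q := fun i => by
      have h1 : |D.clip (y i)| ≤ |D.qmin| + |D.qmax| := by
        rw [abs_le]
        constructor
        · linarith [qmin_le_clip hq (y i), neg_abs_le D.qmin, abs_nonneg D.qmax]
        · linarith [clip_le_qmax (D := D) (y i), le_abs_self D.qmax, abs_nonneg D.qmin]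
      have h2 : x i = D.clip (y i) + e i := by rw [hxe]; simp only [hw]; ring
      rw [h2]
      refine (abs_add_le _ _).trans ?_
      have h3 : |e i| ≤ D.qmax - D.qmin := abs_quantizationError_le hq _ _ _
      linarith
    have hLxK : ∑ i, L x i ^ 2 ≤ N * K ^ 2 := by
      calc ∑ i, L x i ^ 2 ≤ ∑ _i : V, K ^ 2 := Finset.sum_le_sum fun i _ => by
            rw [← sq_abs (L x i)]
            exact pow_le_pow_left₀ (abs_nonneg _) (abs_laplacian_le hM' (habs k) hxQ i) 2
        _ = N * K ^ 2 := by simp [hN]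
    have hdrift := le_sum_mul_laplacian (G := D.G) (A := D.weights k) (a := a) (z := z) (w := w)
      (fun i j hj => ⟨(hweights k i j hj).1, ha.le.trans (hweights k i j hj).1⟩)
      (fun i j => by
        have := sub_clip_mul_nonneg hq ⟨qmin_le_clip hq (y j), clip_le_qmax (y j)⟩ (y i)
        simpa only [hz, hw, sub_sub_sub_cancel_right] using this)
      (fun i => by
        have := sub_clip_mul_nonneg hq havg (y i)
        simpa only [hz, hw, sub_sub_sub_cancel_right] using this)
    have hdis : ∑ i, ∑ j ∈ inNeighbors D.G i, (w i - w j) ^ 2 = D.disagreement y := by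
      simp only [hw, sub_sub_sub_cancel_right, disagreement]
    rw [hdis] at hdrift
    have hzb : 2 * D.average * ∑ i, z i * b i ≤ |D.average| * (∑ i, |b i|) * E := by
      rw [Finset.mul_sum, mul_assoc, Finset.sum_mul, Finset.mul_sum]
      refine Finset.sum_le_sum fun i _ => ?_
      have h1 : 2 * |z i| ≤ E := by
        have := Finset.single_le_sum (f := fun i => z i ^ 2) (fun _ _ => sq_nonneg _)
          (Finset.mem_univ i)
        rw [hEz]
        exact (two_mul_abs_le (z i)).trans (by linarith)
      calc 2 * D.average * (z i * b i) ≤ |2 * D.average * (z i * b i)| := le_abs_self _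
        _ = |D.average| * (|b i| * (2 * |z i|)) := by
            rw [abs_mul, abs_mul, abs_mul, abs_two]; ring
        _ ≤ _ := by gcongr
    have hexpand : D.energy up (k + 1) ω = E - 2 * D.α k * ∑ i, z i * L w i
        + D.α k * (2 * D.average * ∑ i, z i * b i) + D.noise up k ω
        + D.α k ^ 2 * ∑ i, L x i ^ 2 := by
      rw [energy_eq, hEz, hnoise]
      have h1 : ∀ i, (D.estimate up (k + 1) ω i - D.average) ^ 2 = z i ^ 2
          - 2 * D.α k * (z i * L w i) + D.α k * (2 * D.average * (z i * b i))
          + -2 * D.α k * (z i * L e i) + D.α k ^ 2 * L x i ^ 2 := fun i => by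
        have h2 : D.estimate up (k + 1) ω i - D.average = z i - D.α k * L x i := by
          rw [estimate_succ]; simp only [hz, hy, hL, hx]; ring
        have h3 : z i * L x i = z i * L w i - D.average * (z i * b i) + z i * L e i := by
          rw [hLx]; ring
        rw [h2]
        linear_combination (-2 * D.α k) * h3
      simp only [h1, Finset.sum_add_distrib, Finset.sum_sub_distrib, ← Finset.mul_sum]
      ring
    have hdiss : D.dissipation up k ω = D.α k * D.disagreement y := if_pos hB
    rw [hexpand, hdiss]
    have t1 : 2 * D.α k * (a / 2 * D.disagreement y - (∑ i, |b i|) * (∑ i, z i ^ 2) / 2)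
        ≤ 2 * D.α k * ∑ i, z i * L w i := mul_le_mul_of_nonneg_left hdrift (by positivity)
    have t2 := mul_le_mul_of_nonneg_left hzb hα.le
    have t3 : D.α k ^ 2 * ∑ i, L x i ^ 2 ≤ D.α k ^ 2 * (C * E) :=
      mul_le_mul_of_nonneg_left ((hLxK.trans hC1).trans (le_mul_of_one_le_right hC0 hE1))
        (sq_nonneg _)
    have t4 : D.α k * ((∑ i, |b i|) * ∑ i, z i ^ 2) ≤ D.α k * ((∑ i, |b i|) * E) := by
      gcongr
      linarith
    simp only [hb] at t1 t2 t3 t4 ⊢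
    linarith
  · have hx0 : x = fun _ => 0 := by
      funext i; simp [hx, quantize, hB i]
    have he0 : e = fun _ => 0 := by
      funext i; simp [he, quantizationError, hB i]
    have hnoise0 : D.noise up k ω = 0 := by
      rw [hnoise, he0, hL]; simp [laplacian]
    have hsame : D.energy up (k + 1) ω = E := by
      rw [energy_eq, hEz]
      congr 1
      refine Finset.sum_congr rfl fun i _ => ?_
      have h2 : D.estimate up (k + 1) ω i = y i - D.α k * L x i := estimate_succ k ω i
      rw [h2, hx0, hL]
      simp [laplacian, hz]
    have hdiss : D.dissipation up k ω = 0 := by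
      rw [dissipation]
      split_ifs with h
      · have hV : IsEmpty V := ⟨fun i => (h i).ne' (hB i)⟩
        simp [disagreement]
      · rfl
    rw [hsame, hnoise0, hdiss]
    have : 0 ≤ ((1 + |D.average|) * (D.α k * ∑ i, |b i|) + C * D.α k ^ 2) * E := by positivity
    simp only [hb] at this
    linarith

/-! ### Measurability, and the mean of the noise -/

section Probability

variable [mΩ : MeasurableSpace Ω] {P : Measure Ω} {ℱ : Filtration ℕ mΩ}

lemma RandomRounding.measurable_estimate (hup : D.RandomRounding P ℱ up) (k : ℕ) (i : V) :
    Measurable[ℱ k] fun ω => D.estimate up k ω i := by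
  induction k generalizing i with
  | zero => exact measurable_const
  | succ k ih =>
    have hy : ∀ i, Measurable[ℱ (k + 1)] fun ω => D.estimate up k ω i := fun i =>
      (ih i).mono (ℱ.mono (Nat.le_succ k)) le_rfl
    have hx : ∀ i, Measurable[ℱ (k + 1)] fun ω =>
        D.quantize (D.Bc k i) (D.estimate up k ω i) (ω ∈ up k i) := fun i =>
      measurable_quantize (hy i) fun hB => (hup k i hB).1
    simp only [estimate_succ, laplacian]
    exact (hy i).sub ((((hx i).const_mul _).sub
      (Finset.measurable_fun_sum _ fun j _ => (hx j).const_mul _)).const_mul _)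

lemma RandomRounding.stronglyAdapted_energy (hup : D.RandomRounding P ℱ up) :
    StronglyAdapted ℱ (D.energy up) := fun k => by
  have h : Measurable[ℱ k] (D.energy up k) := by
    rw [show D.energy up k = _ from funext (energy_eq k)]
    exact (Finset.measurable_fun_sum _ fun i _ =>
      ((hup.measurable_estimate k i).sub_const _).pow_const 2).const_add 1
  exact h.stronglyMeasurable

lemma RandomRounding.stronglyAdapted_dissipation (hup : D.RandomRounding P ℱ up) :
    StronglyAdapted ℱ (D.dissipation up) := fun k => by
  have h : Measurable[ℱ k] (D.dissipation up k) := by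
    unfold dissipation
    split_ifs
    · have hc : ∀ i, Measurable[ℱ k] fun ω => D.clip (D.estimate up k ω i) := fun i =>
        measurable_clip.comp (hup.measurable_estimate k i)
      exact (Finset.measurable_fun_sum _ fun i _ => Finset.measurable_fun_sum _ fun j _ =>
        ((hc i).sub (hc j)).pow_const 2).const_mul _
    · exact measurable_const
  exact h.stronglyMeasurable

lemma RandomRounding.measurable_quantizationError (hup : D.RandomRounding P ℱ up) (k : ℕ) (i : V) :
    Measurable fun ω => D.quantizationError (D.Bc k i) (D.estimate up k ω i) (ω ∈ up k i) := by
  have hy := (hup.measurable_estimate k i).mono (ℱ.le k) le_rfl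
  unfold quantizationError
  split_ifs
  · exact measurable_const
  · exact (measurable_quantize hy fun hB => ℱ.le _ _ (hup k i hB).1).sub
      (measurable_clip.comp hy)

variable [IsProbabilityMeasure P]

lemma RandomRounding.integrable_quantizationError (hup : D.RandomRounding P ℱ up)
    (hq : D.qmin < D.qmax) (k : ℕ) (i : V) :
    Integrable (fun ω =>
      D.quantizationError (D.Bc k i) (D.estimate up k ω i) (ω ∈ up k i)) P :=
  Integrable.of_bound (hup.measurable_quantizationError k i).aestronglyMeasurable _
    (.of_forall fun _ => abs_quantizationError_le hq _ _ _)

/-- The probabilistic quantizer is unbiased. -/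
lemma RandomRounding.condExp_quantizationError (hup : D.RandomRounding P ℱ up)
    (hq : D.qmin < D.qmax) (k : ℕ) (i : V) :
    P[fun ω => D.quantizationError (D.Bc k i) (D.estimate up k ω i) (ω ∈ up k i) | ℱ k]
      =ᵐ[P] 0 := by
  classical
  rcases Nat.eq_zero_or_pos (D.Bc k i) with hB | hB
  · simp only [hB, quantizationError, if_true]
    rw [condExp_const (ℱ.le k)]
    rfl
  obtain ⟨hm, hcond⟩ := hup k i hB
  have hy := hup.measurable_estimate k i
  set B := D.Bc k i
  set y : Ω → ℝ := fun ω => D.estimate up k ω i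
  set f : Ω → ℝ := fun ω => D.cell B * (⌈D.position B (y ω)⌉ - ⌊D.position B (y ω)⌋)
  set g : Ω → ℝ := (up k i).indicator fun _ => (1 : ℝ)
  set p : Ω → ℝ := fun ω => D.roundUpProb B (y ω)
  have heq : (fun ω => D.quantizationError B (y ω) (ω ∈ up k i)) = f * (g - p) := by
    funext ω
    rw [quantizationError_eq hq hB]
    simp only [Pi.mul_apply, Pi.sub_apply, f, g, p, Set.indicator_apply]
  have hf : StronglyMeasurable[ℱ k] f := by
    have : Measurable[ℱ k] f :=
      (((measurable_ceil_position B).comp hy).sub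
        ((measurable_floor_position B).comp hy)).const_mul _
    exact this.stronglyMeasurable
  have hp : StronglyMeasurable[ℱ k] p := by
    have : Measurable[ℱ k] p :=
      ((measurable_position B).comp hy).sub ((measurable_floor_position B).comp hy)
    exact this.stronglyMeasurable
  have hpi : Integrable p P := by
    refine Integrable.of_bound (hp.mono (ℱ.le k)).aestronglyMeasurable 1 (.of_forall fun ω => ?_)
    obtain ⟨h1, h2⟩ := roundUpProb_mem (D := D) B (y ω)
    rwa [Real.norm_of_nonneg h1]
  have hgi : Integrable g P := (integrable_const 1).indicator (ℱ.le _ _ hm)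
  have hfb : ∀ ω, ‖f ω‖ ≤ D.cell B * 1 := fun ω => by
    obtain ⟨h1, h2⟩ := ceil_sub_floor_mem (D.position B (y ω))
    have := cell_pos hq hB
    rw [Real.norm_of_nonneg (mul_nonneg this.le h1)]
    gcongr
  rw [heq]
  filter_upwards [condExp_stronglyMeasurable_mul_of_bound (ℱ.le k) hf (hgi.sub hpi) _
    (.of_forall hfb), condExp_sub hgi hpi (ℱ k), hcond] with ω h1 h2 h3
  rw [h1, Pi.mul_apply, h2, Pi.sub_apply, h3, condExp_of_stronglyMeasurable (ℱ.le k) hp hpi]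
  simp [p, y]

lemma RandomRounding.noise_integrable_and_condExp (hup : D.RandomRounding P ℱ up)
    (hq : D.qmin < D.qmax) (hb : ∀ k, ∃ c, ∀ ω, D.energy up k ω ≤ c) (k : ℕ) :
    Integrable (D.noise up k) P ∧ P[D.noise up k | ℱ k] =ᵐ[P] 0 := by
  set e : V → Ω → ℝ := fun i ω =>
    D.quantizationError (D.Bc k i) (D.estimate up k ω i) (ω ∈ up k i)
  set T : V → Ω → ℝ := fun j ω => -2 * D.α k *
    (outFlow D.G (D.weights k) j * (D.estimate up k ω j - D.average)
      - ∑ i ∈ outNeighbors D.G j, D.weights k i j * (D.estimate up k ω i - D.average)) with hT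
  have heq : D.noise up k = ∑ j, T j * e j := by
    funext ω
    rw [noise, sum_mul_laplacian, Finset.mul_sum, Finset.sum_apply]
    exact Finset.sum_congr rfl fun j _ => by simp only [T, e, Pi.mul_apply]; ring
  have hTm : ∀ j, StronglyMeasurable[ℱ k] (T j) := fun j => by
    have hy : ∀ i, Measurable[ℱ k] fun ω => D.estimate up k ω i - D.average := fun i =>
      (hup.measurable_estimate k i).sub_const _
    have : Measurable[ℱ k] (T j) := (((hy j).const_mul _).sub
      (Finset.measurable_fun_sum _ fun i _ => (hy i).const_mul _)).const_mul _
    exact this.stronglyMeasurable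
  obtain ⟨c, hc⟩ := hb k
  have hTb : ∀ j, ∃ c', ∀ ω, ‖T j ω‖ ≤ c' := fun j => by
    refine ⟨|-2 * D.α k| * (|outFlow D.G (D.weights k) j| * c
      + ∑ i ∈ outNeighbors D.G j, |D.weights k i j| * c), fun ω => ?_⟩
    have hz : ∀ i, |D.estimate up k ω i - D.average| ≤ c := fun i =>
      (abs_estimate_sub_average_le k ω i).trans (hc ω)
    rw [Real.norm_eq_abs, hT, abs_mul]
    refine mul_le_mul_of_nonneg_left ((abs_sub_le _ 0 _).trans ?_) (abs_nonneg _)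
    rw [sub_zero, zero_sub, abs_neg, abs_mul]
    refine add_le_add (mul_le_mul_of_nonneg_left (hz j) (abs_nonneg _))
      ((Finset.abs_sum_le_sum_abs _ _).trans (Finset.sum_le_sum fun i _ => ?_))
    rw [abs_mul]
    exact mul_le_mul_of_nonneg_left (hz i) (abs_nonneg _)
  have hei : ∀ j, Integrable (e j) P := hup.integrable_quantizationError hq k
  have hTei : ∀ j, Integrable (T j * e j) P := fun j => by
    obtain ⟨c', hc'⟩ := hTb j
    exact (hei j).bdd_mul ((hTm j).mono (ℱ.le k)).aestronglyMeasurable (.of_forall hc')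
  have hz : ∀ j, P[T j * e j | ℱ k] =ᵐ[P] 0 := fun j => by
    obtain ⟨c', hc'⟩ := hTb j
    filter_upwards [condExp_stronglyMeasurable_mul_of_bound (ℱ.le k) (hTm j) (hei j) c'
      (.of_forall hc'), hup.condExp_quantizationError hq k j] with ω h1 h2
    rw [h1, Pi.mul_apply, h2]
    simp
  rw [heq]
  refine ⟨integrable_finsetSum' _ fun j _ => hTei j, ?_⟩
  filter_upwards [condExp_finsetSum (fun j (_ : j ∈ Finset.univ) => hTei j) (ℱ k),
    ae_all_iff.2 hz] with ω h1 h2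
  rw [h1, Finset.sum_apply]
  simp [h2]

end Probability

/-! ### Vanishing dissipation forces consensus -/

/-- A vector with the right average and without disagreement is constant. Clipping does not move a
value across the average, so the common clipped value is the average. If the average is an end of
the range, then this only says that all entries lie on one side of it, and their mean decides. -/
lemma eq_average_of_disagreement_eq_zero (hconn : StronglyConnected D.G) (hq : D.qmin < D.qmax)
    (havg : D.InformativeAverage) {y : V → ℝ} (hy : ∑ i, (y i - D.average) = 0)
    (h : D.disagreement y = 0) (i : V) : y i = D.average := by
  have hedge : ∀ i j, D.G.Adj i j → D.clip (y i) = D.clip (y j) := fun i j hij => by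
    have h1 := (Finset.sum_eq_zero_iff_of_nonneg fun i _ =>
      Finset.sum_nonneg fun j _ => sq_nonneg _).1 h j (Finset.mem_univ _)
    have h2 := (Finset.sum_eq_zero_iff_of_nonneg fun j _ => sq_nonneg _).1 h1 i (by simpa)
    exact (sub_eq_zero.1 (pow_eq_zero_iff two_ne_zero |>.1 h2)).symm
  have hconst : ∀ i j, D.clip (y i) = D.clip (y j) := fun i j => by
    induction hconn i j with
    | refl => rfl
    | tail _ hbc ih => exact ih.trans (hedge _ _ hbc)
  obtain ⟨h1, h2⟩ := havg
  have hle : ∀ y, y ≤ D.average → D.clip y ≤ D.average := fun y hy =>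
    (min_le_left _ _).trans (max_le hy h1)
  have hge : ∀ y, D.average ≤ y → D.average ≤ D.clip y := fun y hy =>
    le_min (le_max_of_le_left hy) h2
  have hclip : ∀ i, D.clip (y i) = D.average := fun i => by
    refine le_antisymm ?_ ?_
    · obtain ⟨j, -, hj⟩ := Finset.exists_le_of_sum_le (s := Finset.univ) (f := fun i => y i)
        (g := fun _ => D.average) ⟨i, Finset.mem_univ i⟩
        (by rw [← sub_nonpos, ← Finset.sum_sub_distrib, hy])
      exact (hconst i j).trans_le (hle _ hj)
    · obtain ⟨j, -, hj⟩ := Finset.exists_le_of_sum_le (s := Finset.univ) (f := fun _ => D.average)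
        (g := fun i => y i) ⟨i, Finset.mem_univ i⟩
        (by rw [← sub_nonneg, ← Finset.sum_sub_distrib, hy])
      exact (hge _ hj).trans_eq (hconst j i)
  have hside : (∀ i, 0 ≤ y i - D.average) ∨ ∀ i, 0 ≤ -(y i - D.average) := by
    rcases h2.lt_or_eq with hlt | heq
    · refine Or.inr fun i => ?_
      have h3 : max (y i) D.qmin ≤ D.average := by
        rcases min_le_iff.1 (hclip i).le with h | h
        · exact h
        · exact absurd h hlt.not_ge
      linarith [le_max_left (y i) D.qmin]
    · refine Or.inl fun i => ?_
      rcases le_max_iff.1 ((hclip i).ge.trans (min_le_left _ _)) with h | h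
      · linarith
      · rw [heq] at h; exact absurd h hq.not_ge
  rcases hside with h3 | h3
  · have := (Finset.sum_eq_zero_iff_of_nonneg fun i _ => h3 i).1 hy i (Finset.mem_univ i)
    linarith
  · have h4 : ∑ i, -(y i - D.average) = 0 := by rw [Finset.sum_neg_distrib, hy, neg_zero]
    have := (Finset.sum_eq_zero_iff_of_nonneg fun i _ => h3 i).1 h4 i (Finset.mem_univ i)
    linarith

lemma continuous_disagreement :
    Continuous fun y : EuclideanSpace ℝ V => D.disagreement y := by
  have hc : Continuous D.clip := (continuous_id.max continuous_const).min continuous_const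
  unfold disagreement
  fun_prop

open Classical in
/-- The step sizes at the transmission times are not summable: they are non-increasing and every
window contains a transmission time. -/
lemma not_summable_transmission_steps (hα : D.ConsensusSteps) (hBc : D.ConsensusBits) :
    ¬ Summable fun k => if ∀ i, 0 < D.Bc k i then D.α k else 0 := by
  obtain ⟨hα0, hαs, hdiv, -⟩ := hα
  obtain ⟨W, hW, B, hB, hBW, hBB⟩ := hBc
  have hanti : Antitone D.α := antitone_nat_of_succ_le hαs
  intro hsum
  set g : ℕ → ℝ := fun k => if ∀ i, 0 < D.Bc k i then D.α k else 0 with hg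
  have hg0 : ∀ k, 0 ≤ g k := fun k => by
    simp only [hg]; split_ifs
    exacts [(hα0 k).le, le_rfl]
  have hwin : ∀ n, D.α ((n + 1) * W) ≤ ∑ k ∈ Finset.Ico (n * W) ((n + 1) * W), g k := fun n => by
    obtain ⟨t, ht, hBt⟩ := Finset.exists_ne_zero_of_sum_ne_zero (Nat.one_le_iff_ne_zero.1 (hBW n))
    have hall : ∀ i, 0 < D.Bc t i := fun i =>
      (Nat.pos_of_ne_zero hBt).trans_le ((hBB t i).1 (Nat.pos_of_ne_zero hBt))
    calc D.α ((n + 1) * W) ≤ D.α t := hanti (Finset.mem_Ico.1 ht).2.le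
      _ = g t := by simp only [hg]; rw [if_pos hall]
      _ ≤ _ := Finset.single_le_sum (fun k _ => hg0 k) ht
  -- the steps of a window are at most `W` times its first step, which the previous window pays for
  have hmain : ∀ n, ∑ k ∈ Finset.range (n * W), D.α k + W * D.α (n * W)
      ≤ W * D.α 0 + W * ∑ k ∈ Finset.range (n * W), g k := fun n => by
    induction n with
    | zero => simp
    | succ n ih =>
      have hle : n * W ≤ (n + 1) * W := Nat.mul_le_mul_right _ (Nat.le_succ n)
      have h1 : ∑ k ∈ Finset.Ico (n * W) ((n + 1) * W), D.α k ≤ W * D.α (n * W) := by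
        refine (Finset.sum_le_card_nsmul _ _ _ fun k hk => hanti (Finset.mem_Ico.1 hk).1).trans ?_
        rw [Nat.card_Ico, nsmul_eq_mul, add_mul, one_mul, Nat.add_sub_cancel_left]
      have h2 := mul_le_mul_of_nonneg_left (hwin n) (Nat.cast_nonneg (α := ℝ) W)
      rw [← Finset.sum_range_add_sum_Ico D.α hle, ← Finset.sum_range_add_sum_Ico g hle]
      linarith
  obtain ⟨n, hn⟩ := (hdiv.eventually_gt_atTop (W * D.α 0 + W * ∑' k, g k)).exists
  have h1 : ∑ k ∈ Finset.Icc 1 n, D.α k ≤ ∑ k ∈ Finset.range ((n + 1) * W), D.α k :=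
    Finset.sum_le_sum_of_subset_of_nonneg (fun k hk => by
      rw [Finset.mem_Icc] at hk
      rw [Finset.mem_range]
      exact (by omega : k < n + 1).trans_le (Nat.le_mul_of_pos_right _ hW))
      fun k _ _ => (hα0 k).le
  have h2 := hmain (n + 1)
  have h3 := mul_le_mul_of_nonneg_left (hsum.sum_le_tsum (Finset.range ((n + 1) * W))
    fun k _ => hg0 k) (Nat.cast_nonneg (α := ℝ) W)
  have h4 : 0 ≤ W * D.α ((n + 1) * W) := mul_nonneg (Nat.cast_nonneg _) (hα0 _).le
  linarith

/-- If the distance from the average converged to a positive limit, then the disagreement would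
eventually stay away from zero, by compactness, and the dissipation would not be summable. -/
lemma tendsto_estimate [Nonempty V] (hconn : StronglyConnected D.G) (hq : D.qmin < D.qmax)
    (havg : D.InformativeAverage) (hα : D.ConsensusSteps) (hBc : D.ConsensusBits) {ω : Ω} {v : ℝ}
    (hv : Tendsto (fun k => D.energy up k ω) atTop (𝓝 v))
    (hS : Summable fun k => D.dissipation up k ω) :
    Tendsto (fun k => D.estimate up k ω) atTop (𝓝 D.averageVector) := by
  have hv1 : 1 ≤ v := ge_of_tendsto' hv fun k => one_le_energy k ω
  have hsq : Tendsto (fun k => ‖D.estimate up k ω - D.averageVector‖ ^ 2) atTop (𝓝 (v - 1)) := by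
    simpa [energy] using hv.sub_const 1
  rcases hv1.eq_or_lt with rfl | hlt
  · rw [tendsto_iff_norm_sub_tendsto_zero]
    have := (Real.continuous_sqrt.tendsto _).comp hsq
    simpa [Function.comp_def, Real.sqrt_sq] using this
  exfalso
  set K : Set (EuclideanSpace ℝ V) := Metric.closedBall D.averageVector v ∩
    {y | (v - 1) / 2 ≤ ‖y - D.averageVector‖ ^ 2 ∧ ∑ i, (y i - D.average) = 0} with hK
  have hKc : IsCompact K := by
    refine (isCompact_closedBall _ _).inter_right (IsClosed.inter ?_ ?_)
    · exact isClosed_le continuous_const ((continuous_id.sub continuous_const).norm.pow 2)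
    · exact isClosed_eq (f := fun y : EuclideanSpace ℝ V => ∑ i, (y i - D.average)) (by fun_prop)
        continuous_const
  have hyK : ∀ᶠ k in atTop, D.estimate up k ω ∈ K := by
    filter_upwards [hsq.eventually_const_le (by linarith : (v - 1) / 2 < v - 1),
      hsq.eventually_le_const (by nlinarith : v - 1 < v ^ 2)] with k h1 h2
    refine ⟨?_, h1, sum_estimate_sub_average k ω⟩
    rw [mem_closedBall_iff_norm]
    exact le_of_sq_le_sq h2 (by linarith)
  obtain ⟨k₀, hk₀⟩ := hyK.exists
  obtain ⟨y, hyK', hmin⟩ := hKc.exists_isMinOn ⟨_, hk₀⟩ continuous_disagreement.continuousOn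
  have hδ : 0 < D.disagreement y := by
    refine lt_of_le_of_ne (disagreement_nonneg _) fun h0 => ?_
    have hyavg : y = D.averageVector := by
      ext i
      exact eq_average_of_disagreement_eq_zero hconn hq havg hyK'.2.2 h0.symm i
    have := hyK'.2.1
    rw [hyavg, sub_self, norm_zero] at this
    norm_num at this
    linarith
  refine not_summable_transmission_steps hα hBc
    (Summable.of_norm_bounded_eventually_nat (hS.mul_left (D.disagreement y)⁻¹) ?_)
  filter_upwards [hyK] with k hk
  unfold dissipation
  split_ifs with hB
  · rw [Real.norm_of_nonneg (hα.1 k).le, mul_left_comm]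
    refine le_mul_of_one_le_right (hα.1 k).le ?_
    rw [inv_mul_eq_div, one_le_div hδ]
    exact hmin hk
  · simp

end Input

end QuantizedConsensus

open QuantizedConsensus Input

theorem theorem2 {V : Type*} [Fintype V] [Nonempty V]
    (D : QuantizedConsensus.Input V)
    (hloop : ∀ i, ¬ D.G.Adj i i)
    (hconn : QuantizedConsensus.StronglyConnected D.G)
    (hq : D.qmin < D.qmax)
    (hγ : D.BalancingStepAndWeights)
    (hBw : D.BalancingBits)
    (hBc : D.ConsensusBits)
    (havg : D.InformativeAverage)
    (hα : D.ConsensusSteps)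
    {Ω : Type*} [mΩ : MeasurableSpace Ω] (P : Measure Ω) [IsProbabilityMeasure P]
    (ℱ : Filtration ℕ mΩ) (up : ℕ → V → Set Ω)
    (hup : D.RandomRounding P ℱ up) :
    (∀ᵐ ω ∂P, Tendsto (fun k => D.estimate up k ω) atTop (𝓝 D.averageVector)) ∧
    ∀ p : ℕ, 0 < p →
      (∀ k, Integrable (fun ω => ‖D.estimate up k ω - D.averageVector‖ ^ p) P) ∧
      Tendsto (fun k => ∫ ω, ‖D.estimate up k ω - D.averageVector‖ ^ p ∂P) atTop (𝓝 0) := by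
  have hα' := hα
  obtain ⟨hα0, -, -, hα2⟩ := hα'
  obtain ⟨a, M, ha, -, hw⟩ := exists_weights_bounds hconn hγ
  obtain ⟨C, hC, hstep⟩ := exists_energy_succ_le hq havg hα0 hBc.synchronous ha hw
  set ε : ℕ → ℝ := fun k => (1 + |D.average|)
    * (D.α k * ∑ i, |balance D.G (D.weights k) i|) + C * D.α k ^ 2 with hε
  have hε0 : ∀ k, 0 ≤ ε k := fun k => by have := hα0 k; positivity
  have hεs : Summable ε :=
    ((summable_step_mul_balance hconn hγ hBw hα2 hα0).mul_left _).add (hα2.mul_left C)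
  have hnoise : ∀ k ω, |D.noise up k ω| ≤ C * D.α k * D.energy up k ω :=
    fun k ω => (hstep up k ω).1
  have hdecr : ∀ k ω, D.energy up (k + 1) ω
      ≤ (1 + ε k) * D.energy up k ω - a * D.dissipation up k ω + D.noise up k ω :=
    fun k ω => (hstep up k ω).2
  have hE1 : ∀ k ω, 1 ≤ D.energy up k ω := one_le_energy
  have hE0 : ∀ k ω, 0 ≤ D.energy up k ω := fun k ω => zero_le_one.trans (hE1 k ω)
  have hS0 : ∀ k ω, 0 ≤ D.dissipation up k ω := fun k ω => by
    unfold dissipation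
    split_ifs
    exacts [mul_nonneg (hα0 k).le (disagreement_nonneg _), le_rfl]
  have hdecr' : ∀ k ω, D.energy up (k + 1) ω
      ≤ (1 + ε k) * D.energy up k ω + D.noise up k ω := fun k ω => by
    linarith [hdecr k ω, mul_nonneg ha.le (hS0 k ω)]
  have hEb : ∀ k, ∃ c, ∀ ω, D.energy up k ω ≤ c := fun k => by
    induction k with
    | zero => exact ⟨1 + ‖WithLp.toLp 2 D.y₀ - D.averageVector‖ ^ 2, fun ω => le_rfl⟩
    | succ k ih =>
      obtain ⟨c, hc⟩ := ih
      refine ⟨(1 + ε k + C * D.α k) * c, fun ω => ?_⟩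
      have h1 := (le_abs_self _).trans (hnoise k ω)
      have h2 : 0 ≤ 1 + ε k + C * D.α k := by
        have := hα0 k
        have := hε0 k
        positivity
      linarith [hdecr' k ω, mul_le_mul_of_nonneg_left (hc ω) h2]
  have hEa : StronglyAdapted ℱ (D.energy up) := hup.stronglyAdapted_energy
  have hEi : ∀ k, Integrable (D.energy up k) P := fun k => by
    obtain ⟨c, hc⟩ := hEb k
    exact Integrable.of_bound ((hEa k).mono (ℱ.le k)).aestronglyMeasurable c
      (.of_forall fun ω => by rw [Real.norm_of_nonneg (hE0 k ω)]; exact hc ω)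
  have hξ := hup.noise_integrable_and_condExp hq hEb
  have hSa : StronglyAdapted ℱ fun k ω => a * D.dissipation up k ω := fun k =>
    (hup.stronglyAdapted_dissipation k).const_mul a
  -- the dissipation is integrable because it is dominated by the other terms of the recursion
  have hSi : ∀ k, Integrable (fun ω => a * D.dissipation up k ω) P := fun k => by
    refine Integrable.mono' (((hEi k).const_mul (1 + ε k)).add (hξ k).1)
      ((hSa k).mono (ℱ.le k)).aestronglyMeasurable (.of_forall fun ω => ?_)
    rw [Real.norm_of_nonneg (mul_nonneg ha.le (hS0 k ω))]
    simp only [Pi.add_apply]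
    linarith [hdecr k ω, hE0 (k + 1) ω]
  have hae : ∀ᵐ ω ∂P, Tendsto (fun k => D.estimate up k ω) atTop (𝓝 D.averageVector) := by
    filter_upwards [ae_tendsto_and_summable_of_almost_supermartingale hEa hE0 hEi hSa
      (fun k ω => mul_nonneg ha.le (hS0 k ω)) hSi (fun k => (hξ k).1) (fun k => (hξ k).2)
      hε0 hεs hdecr] with ω ⟨⟨v, hv⟩, hsum⟩
    exact tendsto_estimate hconn hq havg hα hBc hv ((summable_mul_left_iff ha.ne').1 hsum)
  refine ⟨hae, fun p hp => ?_⟩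
  set Y : ℕ → Ω → ℝ := fun k ω => ‖D.estimate up k ω - D.averageVector‖ ^ p with hY
  have hYE : ∀ k ω, Y k ω ^ 2 ≤ D.energy up k ω ^ p := fun k ω => by
    rw [hY, ← pow_mul, mul_comm, pow_mul]
    refine pow_le_pow_left₀ (sq_nonneg _) ?_ p
    rw [energy]; linarith
  have hYm : ∀ k, AEStronglyMeasurable (Y k) P := fun k => by
    have h1 : Y k = fun ω => √(D.energy up k ω - 1) ^ p := by
      funext ω
      rw [energy, add_sub_cancel_left, Real.sqrt_sq (norm_nonneg _)]
    have h2 := ((hEa k).mono (ℱ.le k)).measurable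
    rw [h1]
    exact (((h2.sub_const 1).sqrt).pow_const p).aestronglyMeasurable
  have hY0 : ∀ k ω, 0 ≤ Y k ω := fun k ω => by positivity
  have hpow : ∀ k, Integrable (fun ω => D.energy up k ω ^ p) P := fun k => by
    obtain ⟨c, hc⟩ := hEb k
    refine Integrable.of_bound (((hEa k).mono (ℱ.le k)).pow p).aestronglyMeasurable (c ^ p)
      (.of_forall fun ω => ?_)
    rw [Real.norm_of_nonneg (pow_nonneg (hE0 k ω) p)]
    exact pow_le_pow_left₀ (hE0 k ω) (hc ω) p
  have hYi2 : ∀ k, Integrable (fun ω => Y k ω ^ 2) P := fun k =>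
    (hpow k).mono' ((hYm k).pow 2) (.of_forall fun ω => by
      rw [Real.norm_of_nonneg (sq_nonneg _)]; exact hYE k ω)
  obtain ⟨C', hC'⟩ := exists_integral_pow_le_of_almost_supermartingale hEa hE0 hEb
    (fun k => (hξ k).1) (fun k => (hξ k).2) hε0 hεs (s := fun k => C * D.α k)
    (fun k => mul_nonneg hC (hα0 k).le) (by simpa only [mul_pow] using hα2.mul_left (C ^ 2))
    hnoise hdecr' p
  refine ⟨fun k => ((memLp_two_iff_integrable_sq (hYm k)).2 (hYi2 k)).integrable one_le_two,
    tendsto_integral_zero_of_sq_bounded hYm hY0 hYi2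
      (fun k => (integral_mono (hYi2 k) (hpow k) (hYE k)).trans (hC' k)) ?_⟩
  filter_upwards [hae] with ω hω
  have := (tendsto_iff_norm_sub_tendsto_zero.1 hω).pow p
  rwa [zero_pow hp.ne'] at this
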